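/- Let $p$ be an odd prime, let $n$ be a nonzero integer, and let $\xi\in\mathbb C$ be a primitive $p$-th root of unity. Let $J=\begin{pmatrix}0&1\\-1&0\end{pmatrix}$ with blocks of size $(p-1)/2$, and let $\mathrm{Sp}(p-1,\mathbb Z[1/n])$ be the group of matrices $M$ over $\mathbb Z[1/n]$ with $M^{\mathrm T}JM=J$. Let $I$ be the set of pairs $(\mathfrak a,a)$, where $\mathfrak a\subseteq\mathbb Z[1/n][\xi]$ is an ideal and $0\neq a\in\mathbb Z[1/n][\xi]$ is an element with $a=\overline a$ and $\mathfrak a\overline{\mathfrak a}=(a)$; here $\overline{\mathfrak a}$ is the ideal generated by the complex conjugates of the elements of $\mathfrak a$. Write $(\mathfrak a,a)\sim(\mathfrak b,b)$ if there are nonzero $\lambda,\mu\in\mathbb Z[1/n][\xi]$ with $\lambda\mathfrak a=\mu\mathfrak b$ and $\lambda\overline\lambda a=\mu\overline\mu b$. This is an equivalence relation on $I$; let $[\mathfrak a,a]$ denote the class of $(\mathfrak a,a)$ and let $\mathcal I$ be the set of classes. Then there is a bijection $\psi$ from the set of conjugacy classes of elements of order $p$ in $\mathrm{Sp}(p-1,\mathbb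 Z[1/n])$ to $\mathcal I$ with the following property. For every $Y\in\mathrm{Sp}(p-1,\mathbb Z[1/n])$ of order $p$ and every $(\mathfrak a,a)\in I$, the class of $Y$ is mapped to $[\mathfrak a,a]$ if and only if there is a nonzero vector $\alpha\in(\mathbb Z[1/n][\xi])^{p-1}$ with $Y\alpha=\xi\alpha$ such that $\mathfrak a$ is the $\mathbb Z[1/n]$-module generated by the entries of $\alpha$ and $a=D^{-1}\alpha^{\mathrm T}J\overline\alpha$, where $D=p\,\xi^{(p+1)/2}/(\xi-1)$. -/

import Mathlib

namespace SpPairs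

open ComplexConjugate

/-- The ring `ℤ[1/n]`, as a subring of `ℂ`. -/
noncomputable abbrev ZInv (n : ℤ) : Subalgebra ℤ ℂ :=
  Algebra.adjoin ℤ {((n : ℂ))⁻¹}

/-- The ring `ℤ[1/n][ξ]`, as a subring of `ℂ`. -/
noncomputable abbrev ZInvXi (n : ℤ) (ξ : ℂ) : Subalgebra (ZInv n) ℂ :=
  Algebra.adjoin (ZInv n) {ξ}

/-- The symplectic group `Sp(p - 1, ℤ[1/n])` for odd `p`. -/
noncomputable abbrev Sp (p : ℕ) (n : ℤ) :=
  Matrix.symplecticGroup (Fin ((p - 1) / 2)) (ZInv n)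

/-- The conjugacy classes of `Sp(p - 1, ℤ[1/n])` that consist of elements of order `p`. -/
abbrev OrderPClasses (p : ℕ) (n : ℤ) :=
  {c : ConjClasses (Sp p n) // ∃ Y : Sp p n, orderOf Y = p ∧ ConjClasses.mk Y = c}

/-- The ideal generated by the complex conjugates of the elements of an ideal. -/
noncomputable def conjIdeal {n : ℤ} {ξ : ℂ} (I : Ideal (ZInvXi n ξ)) : Ideal (ZInvXi n ξ) :=
  Ideal.span {y | ∃ x ∈ I, (y : ℂ) = conj (x : ℂ)}

/-- The pairs `(𝔞, a)` of an ideal `𝔞` of `ℤ[1/n][ξ]` and a nonzero real element `a` with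
`𝔞 * conj 𝔞 = (a)`. -/
@[ext]
structure IdealPair (n : ℤ) (ξ : ℂ) where
  /-- The ideal `𝔞`. -/
  ideal : Ideal (ZInvXi n ξ)
  /-- The element `a`. -/
  gen : ZInvXi n ξ
  gen_ne_zero : gen ≠ 0
  conj_gen : conj (gen : ℂ) = gen
  mul_conj : ideal * conjIdeal ideal = Ideal.span {gen}

/-- `(𝔞, a) ∼ (𝔟, b)`: there are nonzero `l`, `m` in `ℤ[1/n][ξ]` with `l 𝔞 = m 𝔟` and
`l * conj l * a = m * conj m * b`. -/
def IdealPair.Rel {n : ℤ} {ξ : ℂ} (P Q : IdealPair n ξ) : Prop :=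
  ∃ l m : ZInvXi n ξ, l ≠ 0 ∧ m ≠ 0 ∧
    Ideal.span {l} * P.ideal = Ideal.span {m} * Q.ideal ∧
    (l : ℂ) * conj (l : ℂ) * P.gen = (m : ℂ) * conj (m : ℂ) * Q.gen

theorem IdealPair.rel_equivalence (n : ℤ) (ξ : ℂ) :
    Equivalence (IdealPair.Rel (n := n) (ξ := ξ)) where
  refl P := ⟨1, 1, one_ne_zero, one_ne_zero, rfl, rfl⟩
  symm := fun ⟨l, m, hl, hm, h, h'⟩ => ⟨m, l, hm, hl, h.symm, h'.symm⟩
  trans := by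
    rintro P Q T ⟨l, m, hl, hm, h, h'⟩ ⟨l', m', hl', hm', k, k'⟩
    refine ⟨l' * l, m * m', mul_ne_zero hl' hl, mul_ne_zero hm hm', ?_, ?_⟩
    · rw [← Ideal.span_singleton_mul_span_singleton, ← Ideal.span_singleton_mul_span_singleton,
        mul_assoc, h, mul_left_comm, k, mul_assoc]
    · push_cast
      rw [map_mul, map_mul]
      linear_combination (l' : ℂ) * conj (l' : ℂ) * h' + (m : ℂ) * conj (m : ℂ) * k'

/-- The equivalence relation on pairs, as a setoid. -/
instance IdealPair.setoid (n : ℤ) (ξ : ℂ) : Setoid (IdealPair n ξ) :=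
  ⟨IdealPair.Rel, IdealPair.rel_equivalence n ξ⟩

/-- The set of equivalence classes `[𝔞, a]`. -/
abbrev PairClasses (n : ℤ) (ξ : ℂ) := Quotient (IdealPair.setoid n ξ)

/-- The generator `D = p ξ ^ ((p + 1) / 2) / (ξ - 1)` of the different of `ℤ[1/n][ξ]`. -/
noncomputable def diffGen (p : ℕ) (ξ : ℂ) : ℂ :=
  p * ξ ^ ((p + 1) / 2) / (ξ - 1)

/-- `αᵀ J (conj α)` for the matrix `J` with blocks `0, 1, -1, 0`. -/
def sympForm {l : Type*} [Fintype l] [DecidableEq l] (α : l ⊕ l → ℂ) : ℂ :=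
  α ⬝ᵥ ((Matrix.fromBlocks 0 1 (-1) 0 : Matrix (l ⊕ l) (l ⊕ l) ℂ).mulVec
    fun i => conj (α i))

/-- `Y` has an eigenvector `α` for the eigenvalue `ξ`, with entries in `ℤ[1/n][ξ]`, such that
`𝔞` is the `ℤ[1/n]`-module generated by the entries of `α` and `a = D⁻¹ αᵀ J (conj α)`. -/
def Corresponds {p : ℕ} {n : ℤ} {ξ : ℂ} (Y : Sp p n) (P : IdealPair n ξ) : Prop :=
  ∃ α : Fin ((p - 1) / 2) ⊕ Fin ((p - 1) / 2) → ZInvXi n ξ,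
    α ≠ 0 ∧
    ((Y : Matrix _ _ (ZInv n)).map (algebraMap (ZInv n) ℂ)).mulVec (fun i => (α i : ℂ))
      = ξ • (fun i => (α i : ℂ)) ∧
    P.ideal.restrictScalars (ZInv n) = Submodule.span (ZInv n) (Set.range α) ∧
    (P.gen : ℂ) = (diffGen p ξ)⁻¹ * sympForm (fun i => (α i : ℂ))

end SpPairs

namespace SpPairs

open Matrix Module

section TraceForms

variable {F L ι : Type*} [Field F] [Field L] [Algebra F L]

theorem eq_top_of_mul_mem {ξ : L} (hξ : Algebra.adjoin F {ξ} = ⊤) (W : Submodule F L)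
    (hW : ∀ x ∈ W, ξ * x ∈ W) {w : L} (hw : w ∈ W) (hw0 : w ≠ 0) : W = ⊤ := by
  have key : ∀ z : L, ∀ x ∈ W, z * x ∈ W := by
    intro z
    have hz : z ∈ Algebra.adjoin F {ξ} := hξ ▸ Algebra.mem_top
    induction hz using Algebra.adjoin_induction with
    | mem x hx => rw [Set.mem_singleton_iff.1 hx]; exact hW
    | algebraMap r => intro x hx; rw [← Algebra.smul_def]; exact W.smul_mem _ hx
    | add a b _ _ ha hb => intro x hx; rw [add_mul]; exact W.add_mem (ha x hx) (hb x hx)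
    | mul a b _ _ ha hb => intro x hx; rw [mul_assoc]; exact ha _ (hb x hx)
  refine eq_top_iff.2 fun z _ => ?_
  simpa [hw0] using key (z * w⁻¹) w hw

theorem span_eq_top_of_mulVec [Fintype ι] {ξ : L} (hξ : Algebra.adjoin F {ξ} = ⊤)
    {Y : Matrix ι ι F} {v : ι → L} (hv : v ≠ 0) (hY : ∀ i, ξ * v i = ∑ j, Y i j • v j) :
    Submodule.span F (Set.range v) = ⊤ := by
  obtain ⟨i, hi⟩ := Function.ne_iff.1 hv
  refine eq_top_of_mul_mem hξ _ (fun x hx => ?_) (Submodule.subset_span ⟨i, rfl⟩) hi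
  induction hx using Submodule.span_induction with
  | mem x hx =>
    obtain ⟨j, rfl⟩ := hx
    rw [hY]
    exact Submodule.sum_mem _ fun k _ => Submodule.smul_mem _ _ (Submodule.subset_span ⟨k, rfl⟩)
  | zero => simp
  | add a b _ _ ha hb => rw [mul_add]; exact Submodule.add_mem _ ha hb
  | smul r a _ ha => rw [mul_smul_comm]; exact Submodule.smul_mem _ _ ha

theorem linearIndependent_of_mulVec [Fintype ι] {ξ : L} (hξ : Algebra.adjoin F {ξ} = ⊤)
    (hcard : Fintype.card ι = finrank F L)
    {Y : Matrix ι ι F} {v : ι → L} (hv : v ≠ 0) (hY : ∀ i, ξ * v i = ∑ j, Y i j • v j) :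
    LinearIndependent F v :=
  linearIndependent_of_top_le_span_of_card_eq_finrank
    (span_eq_top_of_mulVec hξ hv hY).ge hcard

variable [FiniteDimensional F L] [Algebra.IsSeparable F L] [Fintype ι] [DecidableEq ι]

theorem repr_apply_eq_trace (b : Basis ι F L) (x : L) (i : ι) :
    b.repr x i = Algebra.trace F L (x * b.traceDual i) := by
  conv_lhs => rw [← b.traceDual_traceDual]
  rw [Basis.traceDual_repr_apply, Algebra.traceForm_apply]

theorem sum_mul_traceDual (b : Basis ι F L) : ∑ i, b i * b.traceDual i = 1 := by
  refine sub_eq_zero.1 ((traceForm_nondegenerate F L).1 _ fun x => ?_)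
  rw [Algebra.traceForm_apply, sub_mul, one_mul, map_sub, sub_eq_zero,
    Algebra.trace_eq_matrix_trace b x, Matrix.trace, Finset.sum_mul, map_sum]
  refine Finset.sum_congr rfl fun i _ => ?_
  rw [Matrix.diag_apply, Algebra.leftMulMatrix_eq_repr_mul, repr_apply_eq_trace]
  ring_nf

/-- A bilinear form that is invariant under multiplication by `ξ` is a hermitian trace form. -/
theorem exists_trace_eq_of_invariant {ξ : L} (hξ : Algebra.adjoin F {ξ} = ⊤)
    (τ : L ≃ₐ[F] L) (hτ : τ ξ * ξ = 1) (b : Basis ι F L) {M Y : Matrix ι ι F}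
    (hM : Y * M * Yᵀ = M) (hY : ∀ i, ξ * b i = ∑ j, Y i j • b j) :
    ∃ c : L, ∀ i j, Algebra.trace F L (c * b i * τ (b j)) = M i j := by
  set B : LinearMap.BilinForm F L := Matrix.toBilin b M with hB
  have hBb : ∀ i j, B (b i) (b j) = M i j := fun i j => by
    rw [hB, ← LinearMap.BilinForm.toMatrix_apply b, LinearMap.BilinForm.toMatrix_toBilin]
  have hinv : ∀ x y, B (ξ * x) (ξ * y) = B x y := by
    have : B.comp (LinearMap.mulLeft F ξ) (LinearMap.mulLeft F ξ) = B := by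
      refine LinearMap.BilinForm.ext_basis b fun i j => ?_
      simp only [LinearMap.BilinForm.comp_apply, LinearMap.mulLeft_apply, hY, map_sum, map_smul,
        LinearMap.sum_apply, LinearMap.smul_apply, hBb, smul_eq_mul]
      conv_rhs => rw [← hM]
      simp only [Matrix.mul_apply, Matrix.transpose_apply, Finset.sum_mul, Finset.mul_sum]
      refine Finset.sum_congr rfl fun k _ => Finset.sum_congr rfl fun l _ => ?_
      ring
    intro x y
    conv_rhs => rw [← this]
    rfl
  obtain ⟨c, hc⟩ := ((Algebra.traceForm F L).toDual (traceForm_nondegenerate F L)).surjective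
    (B.flip 1)
  have hc1 : ∀ x, Algebra.trace F L (c * x) = B x 1 := fun x => by
    have := LinearMap.congr_fun hc x
    rwa [LinearMap.BilinForm.toDual_def, Algebra.traceForm_apply] at this
  let W : Submodule F L :=
    { carrier := {y | ∀ x, Algebra.trace F L (c * x * τ y) = B x y}
      add_mem' := fun {y z} hy hz x => by
        rw [map_add, mul_add, map_add, map_add, hy x, hz x]
      zero_mem' := fun x => by simp
      smul_mem' := fun r y hy x => by
        rw [map_smul, mul_smul_comm, map_smul, map_smul, hy x] }
  have hW : W = ⊤ := by
    refine eq_top_of_mul_mem hξ W (fun y hy x => ?_) (w := 1) (fun x => by simp [hc1]) one_ne_zero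
    have h1 := hinv (τ ξ * x) y
    rw [← mul_assoc, mul_comm ξ, hτ, one_mul] at h1
    rw [h1, ← hy, map_mul τ]
    ring_nf
  refine ⟨c, fun i j => ?_⟩
  have : b j ∈ W := hW ▸ Submodule.mem_top
  rw [this, hBb]

/-- If the hermitian trace form with factor `c` has Gram matrix `M`, then `c` times the conjugate
of a basis is expressed by the trace dual basis. -/
theorem mul_conj_eq_sum_traceDual (τ : L ≃ₐ[F] L) (b : Basis ι F L) {M : Matrix ι ι F} {c : L}
    (hc : ∀ i j, Algebra.trace F L (c * b i * τ (b j)) = M i j) (j : ι) :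
    c * τ (b j) = ∑ k, M k j • b.traceDual k := by
  rw [← b.traceDual.sum_repr (c * τ (b j))]
  refine Finset.sum_congr rfl fun k _ => ?_
  rw [Basis.traceDual_repr_apply, Algebra.traceForm_apply, ← hc]
  ring_nf

theorem mul_dotProduct_eq_one (τ : L ≃ₐ[F] L) (b : Basis ι F L) {M : Matrix ι ι F}
    (hM : M * Mᵀ = 1) {c : L} (hc : ∀ i j, Algebra.trace F L (c * b i * τ (b j)) = M i j) :
    c * (b ⬝ᵥ (M.map (algebraMap F L) *ᵥ fun j => τ (b j))) = 1 := by
  have h1 : ∀ m k, ∑ j, M m j * M k j = if m = k then 1 else 0 := fun m k => by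
    have := congr_fun (congr_fun hM m) k
    rwa [Matrix.mul_apply, Matrix.one_apply] at this
  calc c * (b ⬝ᵥ (M.map (algebraMap F L) *ᵥ fun j => τ (b j)))
      = ∑ m, b m * ∑ j, M m j • (c * τ (b j)) := by
        simp only [dotProduct, Matrix.mulVec, Matrix.map_apply, Finset.mul_sum, Algebra.smul_def]
        refine Finset.sum_congr rfl fun m _ => Finset.sum_congr rfl fun j _ => ?_
        ring
    _ = ∑ m, b m * ∑ k, (∑ j, M m j * M k j) • b.traceDual k := by
        refine Finset.sum_congr rfl fun m _ => ?_
        congr 1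
        simp only [mul_conj_eq_sum_traceDual τ b hc, Finset.smul_sum, Finset.sum_smul, smul_smul]
        exact Finset.sum_comm
    _ = 1 := by
        simp only [h1, ite_smul, one_smul, zero_smul, Finset.sum_ite_eq, Finset.mem_univ, if_true]
        exact sum_mul_traceDual b

end TraceForms

section Ideals

open scoped nonZeroDivisors
open FractionalIdeal

variable {R S F L ι : Type*} [CommRing R] [IsDomain R] [IsIntegrallyClosed R]
  [CommRing S] [IsDedekindDomain S] [Field F] [Field L] [Algebra R S] [Algebra R F]
  [Algebra R L] [Algebra S L] [Algebra F L] [IsScalarTower R F L] [IsScalarTower R S L]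
  [IsFractionRing R F] [IsFractionRing S L] [FiniteDimensional F L] [Algebra.IsSeparable F L]
  [IsIntegralClosure S R L] [Fintype ι] [DecidableEq ι]

theorem dual_coeIdeal_eq_of_gram {I : Ideal S} (hI : I ≠ ⊥) {v : ι → S}
    (hv : I.restrictScalars R = Submodule.span R (Set.range v))
    (b : Basis ι F L) (hb : ∀ i, b i = algebraMap S L (v i)) (τ : S ≃ₐ[R] S) (σ : L ≃ₐ[F] L)
    (hσ : ∀ s, σ (algebraMap S L s) = algebraMap S L (τ s)) {M N : Matrix ι ι R}
    (hMN : M * N = 1) {c : L}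
    (hc : ∀ i j, Algebra.trace F L (c * b i * σ (b j)) = algebraMap R F (M i j)) :
    dual R F (I : FractionalIdeal S⁰ L) =
      spanSingleton S⁰ c * ((I.map τ : Ideal S) : FractionalIdeal S⁰ L) := by
  have hI' : (I : FractionalIdeal S⁰ L) ≠ 0 := coeIdeal_ne_zero.2 hI
  have hspan : ((I : FractionalIdeal S⁰ L) : Submodule S L).restrictScalars R =
      Submodule.span R (Set.range b) := by
    have h1 : Set.range b = (IsScalarTower.toAlgHom R S L).toLinearMap '' Set.range v := by
      rw [← Set.range_comp]; exact congr_arg Set.range (funext hb)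
    rw [h1, Submodule.span_image, ← hv]
    rfl
  have hgram : ∀ j, c * σ (b j) = ∑ k, M k j • b.traceDual k := fun j => by
    rw [mul_conj_eq_sum_traceDual σ b (M := M.map (algebraMap R F)) hc]
    simp [algebraMap_smul]
  have hsub : Submodule.span R (Set.range fun j => c * σ (b j)) =
      Submodule.span R (Set.range b.traceDual) := by
    apply le_antisymm <;> rw [Submodule.span_le]
    · rintro _ ⟨j, rfl⟩
      simp only [hgram]
      exact Submodule.sum_mem _ fun k _ => Submodule.smul_mem _ _ (Submodule.subset_span ⟨k, rfl⟩)
    · rintro _ ⟨l, rfl⟩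
      have : b.traceDual l = ∑ j, N j l • (c * σ (b j)) := by
        simp only [hgram, Finset.smul_sum, smul_smul]
        rw [Finset.sum_comm]
        have h1 : ∀ k, ∑ j, N j l * M k j = if k = l then 1 else 0 := fun k => by
          have := congr_fun (congr_fun hMN k) l
          rw [Matrix.mul_apply, Matrix.one_apply] at this
          rw [← this]
          exact Finset.sum_congr rfl fun _ _ => mul_comm _ _
        simp [← Finset.sum_smul, h1]
      rw [this]
      exact Submodule.sum_mem _ fun k _ => Submodule.smul_mem _ _ (Submodule.subset_span ⟨k, rfl⟩)
  apply coeToSubmodule_injective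
  beta_reduce
  rw [coe_dual R F hI']
  apply Submodule.restrictScalars_injective R
  rw [Submodule.traceDual_span_of_basis R _ b hspan, ← hsub]
  ext x
  rw [Submodule.restrictScalars_mem, mem_coe, mem_singleton_mul]
  constructor
  · intro hx
    obtain ⟨r, rfl⟩ := (Submodule.mem_span_range_iff_exists_fun R).1 hx
    refine ⟨algebraMap S L (τ (∑ i, r i • v i)), ?_, ?_⟩
    · refine (mem_coeIdeal _).2 ⟨_, Ideal.mem_map_of_mem τ ?_, rfl⟩
      have : ∑ i, r i • v i ∈ I.restrictScalars R := by
        rw [hv]; exact (Submodule.mem_span_range_iff_exists_fun R).2 ⟨r, rfl⟩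
      exact this
    · simp only [map_sum, Finset.mul_sum, hb, hσ, Algebra.smul_def, map_mul, AlgEquiv.commutes,
        ← IsScalarTower.algebraMap_apply]
      exact Finset.sum_congr rfl fun i _ => by ring
  · rintro ⟨y, hy, rfl⟩
    obtain ⟨s, hs, rfl⟩ := (mem_coeIdeal _).1 hy
    obtain ⟨t, ht, rfl⟩ := (Ideal.mem_map_of_equiv τ s).1 hs
    have ht' : t ∈ I.restrictScalars R := ht
    rw [hv] at ht'
    obtain ⟨r, rfl⟩ := (Submodule.mem_span_range_iff_exists_fun R).1 ht'
    refine (Submodule.mem_span_range_iff_exists_fun R).2 ⟨r, ?_⟩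
    simp only [map_sum, Finset.mul_sum, hb, hσ, Algebra.smul_def, map_mul, AlgEquiv.commutes,
      ← IsScalarTower.algebraMap_apply]
    exact Finset.sum_congr rfl fun i _ => by ring

theorem dual_coeIdeal_eq_iff {I J : Ideal S} (hI : I ≠ ⊥) {D c : L}
    (hD : dual R F (1 : FractionalIdeal S⁰ L) = spanSingleton S⁰ D⁻¹) :
    dual R F (I : FractionalIdeal S⁰ L) = spanSingleton S⁰ c * (J : FractionalIdeal S⁰ L) ↔
      spanSingleton S⁰ c * ((I * J : Ideal S) : FractionalIdeal S⁰ L) =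
        spanSingleton S⁰ D⁻¹ := by
  have hI' : (I : FractionalIdeal S⁰ L) ≠ 0 := coeIdeal_ne_zero.2 hI
  rw [← hD, ← dual_mul_self R F hI', coeIdeal_mul, mul_comm (I : FractionalIdeal S⁰ L), ← mul_assoc]
  exact ⟨fun h => by rw [h], fun h => (mul_right_cancel₀ hI' h).symm⟩

/-- The trace dual of `S = R[ξ]` is generated by the inverse of any generator of the ideal of the
derivative of the minimal polynomial of `ξ`. -/
theorem dual_one_eq_spanSingleton {ξ : S} (hξ : Algebra.adjoin R {ξ} = ⊤)
    (hξ' : Algebra.adjoin F {algebraMap S L ξ} = ⊤) {D : S}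
    (hD : Ideal.span {D} = Ideal.span {Polynomial.aeval ξ (Polynomial.derivative (minpoly R ξ))}) :
    dual R F (1 : FractionalIdeal S⁰ L) = spanSingleton S⁰ (algebraMap S L D)⁻¹ := by
  have : IsTorsionFree R S := by
    have : FaithfulSMul R S := by
      have : FaithfulSMul R L := by
        rw [faithfulSMul_iff_algebraMap_injective, IsScalarTower.algebraMap_eq R F L]
        exact (algebraMap F L).injective.comp (IsFractionRing.injective R F)
      rw [faithfulSMul_iff_algebraMap_injective]
      refine Function.Injective.of_comp (f := algebraMap S L) ?_
      rw [← RingHom.coe_comp, ← IsScalarTower.algebraMap_eq]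
      exact FaithfulSMul.algebraMap_injective R L
    infer_instance
  have h := conductor_mul_differentIdeal R F L ξ hξ'
  rw [conductor_eq_top_of_adjoin_eq_top hξ, Ideal.top_mul, ← hD] at h
  rw [← inv_inv (dual R F 1), ← coeIdeal_differentIdeal R F L S, h, coeIdeal_span_singleton,
    spanSingleton_inv]

end Ideals

section SymplecticBasis

variable {R : Type*} [CommRing R] [IsDomain R] [IsPrincipalIdealRing R]

/-- A unimodular alternating form on a finite free module over a principal ideal domain has
symplectic generators. -/
theorem exists_symplectic_span (n : ℕ) : ∀ {M : Type*} [AddCommGroup M] [Module R M]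
    [Module.Free R M] [Module.Finite R M] (B : M →ₗ[R] M →ₗ[R] R), (∀ x, B x x = 0) →
    Function.Surjective B → finrank R M = n →
    ∃ (m : ℕ) (e f : Fin m → M), (∀ i j, B (e i) (e j) = 0) ∧ (∀ i j, B (f i) (f j) = 0) ∧
      (∀ i j, B (e i) (f j) = if i = j then 1 else 0) ∧
      Submodule.span R (Set.range e ∪ Set.range f) = ⊤ := by
  induction n using Nat.strong_induction_on with
  | _ n ih =>
  intro M _ _ _ _ B hB hs hn
  have hskew : ∀ x y, B x y = -B y x := fun x y => by
    have := hB (x + y)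
    simp only [map_add, LinearMap.add_apply, hB, zero_add, add_zero] at this
    exact eq_neg_of_add_eq_zero_right this
  rcases subsingleton_or_nontrivial M with hM | hM
  · exact ⟨0, Fin.elim0, Fin.elim0, fun i => i.elim0, fun i => i.elim0, fun i => i.elim0,
      Subsingleton.elim _ _⟩
  let b := Module.Free.chooseBasis R M
  obtain ⟨i₀⟩ : Nonempty (Module.Free.ChooseBasisIndex R M) := b.index_nonempty
  obtain ⟨y, hy⟩ := hs (b.coord i₀)
  obtain ⟨e, f, hef⟩ : ∃ e f : M, B e f = 1 :=
    ⟨y, b i₀, by rw [hy, Basis.coord_apply, Basis.repr_self, Finsupp.single_eq_same]⟩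
  have hfe : B f e = -1 := by rw [hskew, hef]
  let N : Submodule R M := LinearMap.ker (B e) ⊓ LinearMap.ker (B f)
  have hNe : ∀ z ∈ N, B e z = 0 := fun z hz => hz.1
  have hNf : ∀ z ∈ N, B f z = 0 := fun z hz => hz.2
  have hNe' : ∀ z ∈ N, B z e = 0 := fun z hz => by rw [hskew, hNe z hz, neg_zero]
  have hNf' : ∀ z ∈ N, B z f = 0 := fun z hz => by rw [hskew, hNf z hz, neg_zero]
  let π : M →ₗ[R] N := LinearMap.codRestrict N
    (LinearMap.id + (B f).smulRight e - (B e).smulRight f) fun z => by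
      constructor <;> simp [hB, hef, hfe]
  have hπ : ∀ z, (π z : M) = z + B f z • e - B e z • f := fun z => rfl
  have hπN : ∀ z : N, π z = z := fun z => by
    ext; rw [hπ, hNe z z.2, hNf z z.2]; simp
  have hlt : finrank R N < n := by
    rw [← hn]
    have h1 := Submodule.finrank_quotient_add_finrank (LinearMap.ker π)
    rw [(π.quotKerEquivOfSurjective fun z => ⟨z, hπN z⟩).finrank_eq] at h1
    have h2 : 0 < finrank R (LinearMap.ker π) := by
      refine Module.finrank_pos_iff_exists_ne_zero.2 ⟨⟨e, ?_⟩, fun h => ?_⟩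
      · rw [LinearMap.mem_ker]
        ext
        rw [hπ]
        simp [hB, hfe]
      · have h0 : e = 0 := congr_arg Subtype.val h
        simp [h0] at hef
    omega
  obtain ⟨m, e', f', he, hf, hef', hsp⟩ := ih _ hlt (B.compl₁₂ N.subtype N.subtype)
    (fun x => hB x) (fun g => by
      obtain ⟨x, hx⟩ := hs (g ∘ₗ π)
      refine ⟨π x, LinearMap.ext fun z => ?_⟩
      have h1 := LinearMap.congr_fun hx z
      simp only [LinearMap.comp_apply, hπN] at h1
      simp [hπ, ← h1, hNe z z.2, hNf z z.2]) rfl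
  simp only [LinearMap.compl₁₂_apply, Submodule.subtype_apply] at he hf hef'
  refine ⟨m + 1, Fin.cons e fun i => (e' i : M), Fin.cons f fun i => (f' i : M), ?_, ?_, ?_, ?_⟩
  · intro i j
    refine Fin.cases ?_ (fun i => ?_) i <;> refine Fin.cases ?_ (fun j => ?_) j <;>
      simp [hB, he, hNe, hNe']
  · intro i j
    refine Fin.cases ?_ (fun i => ?_) i <;> refine Fin.cases ?_ (fun j => ?_) j <;>
      simp [hB, hf, hNf, hNf']
  · intro i j
    refine Fin.cases ?_ (fun i => ?_) i <;> refine Fin.cases ?_ (fun j => ?_) j <;>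
      simp [hef, hef', hNe, hNf', Fin.succ_ne_zero, (Fin.succ_ne_zero _).symm]
  · set T := Submodule.span R (Set.range (Fin.cons e fun i => (e' i : M) : Fin (m + 1) → M) ∪
      Set.range (Fin.cons f fun i => (f' i : M) : Fin (m + 1) → M)) with hT
    have heT : e ∈ T := Submodule.subset_span (Or.inl ⟨0, rfl⟩)
    have hfT : f ∈ T := Submodule.subset_span (Or.inr ⟨0, rfl⟩)
    have hNT : ∀ z : N, (z : M) ∈ T := by
      intro z
      have hz : z ∈ Submodule.span R (Set.range e' ∪ Set.range f') := hsp ▸ Submodule.mem_top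
      induction hz using Submodule.span_induction with
      | mem x hx =>
        rcases hx with ⟨i, rfl⟩ | ⟨i, rfl⟩
        · exact Submodule.subset_span (Or.inl ⟨i.succ, by simp⟩)
        · exact Submodule.subset_span (Or.inr ⟨i.succ, by simp⟩)
      | zero => exact T.zero_mem
      | add x y _ _ hx hy => exact T.add_mem hx hy
      | smul r x _ hx => exact T.smul_mem r hx
    refine eq_top_iff.2 fun z _ => ?_
    have : z = π z - B f z • e + B e z • f := by rw [hπ]; abel
    rw [this]
    exact T.add_mem (T.sub_mem (hNT _) (T.smul_mem _ heT)) (T.smul_mem _ hfT)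

/-- The matrix `0, 1, -1, 0`. -/
abbrev stdJ (l R : Type*) [DecidableEq l] [CommRing R] : Matrix (l ⊕ l) (l ⊕ l) R :=
  Matrix.fromBlocks 0 1 (-1) 0

theorem exists_symplectic_basis {M : Type*} [AddCommGroup M] [Module R M]
    [Module.Free R M] [Module.Finite R M] (B : M →ₗ[R] M →ₗ[R] R) (hB : ∀ x, B x x = 0)
    (hs : Function.Surjective B) {m : ℕ} (hm : finrank R M = m + m) :
    ∃ b : Basis (Fin m ⊕ Fin m) R M, ∀ i j, B (b i) (b j) = stdJ (Fin m) R i j := by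
  obtain ⟨k, e, f, he, hf, hef, hsp⟩ := exists_symplectic_span _ B hB hs rfl
  have hfe : ∀ i j, B (f i) (e j) = -if i = j then 1 else 0 := fun i j => by
    have h := hB (e j + f i)
    simp only [map_add, LinearMap.add_apply, hB, zero_add, add_zero, hef] at h
    rw [eq_neg_iff_add_eq_zero]
    simpa only [eq_comm (a := j)] using h
  have hgram : ∀ i j, B (Sum.elim e f i) (Sum.elim e f j) = stdJ (Fin k) R i j := by
    rintro (i | i) (j | j) <;> simp [he, hf, hef, hfe, Matrix.one_apply]
  have hli : LinearIndependent R (Sum.elim e f) := by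
    rw [Fintype.linearIndependent_iff]
    intro g hg i
    have h : ∀ j, ∑ i, g i * stdJ (Fin k) R i j = 0 := fun j => by
      have := congr_arg (fun z => B z (Sum.elim e f j)) hg
      simpa only [map_sum, map_smul, LinearMap.sum_apply, LinearMap.smul_apply, hgram, smul_eq_mul,
        map_zero, LinearMap.zero_apply] using this
    rcases i with i | i
    · simpa [Matrix.one_apply] using h (Sum.inr i)
    · simpa [Matrix.one_apply] using h (Sum.inl i)
  let b := Basis.mk hli (by rw [Set.Sum.elim_range, hsp])
  obtain rfl : k = m := by
    have := finrank_eq_card_basis b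
    simp only [Fintype.card_sum, Fintype.card_fin] at this
    omega
  exact ⟨b, fun i j => by simp only [b, Basis.mk_apply, hgram]⟩

end SymplecticBasis

theorem mem_symplecticGroup_iff_stdJ {l R : Type*} [Fintype l] [DecidableEq l] [CommRing R]
    {A : Matrix (l ⊕ l) (l ⊕ l) R} :
    A ∈ symplecticGroup l R ↔ A * stdJ l R * Aᵀ = stdJ l R := by
  have : stdJ l R = -J l R := by simp [stdJ, J, Matrix.fromBlocks_neg]
  rw [SymplecticGroup.mem_iff, this, Matrix.mul_neg, Matrix.neg_mul, neg_inj]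

theorem stdJ_mul_transpose (l R : Type*) [Fintype l] [DecidableEq l] [CommRing R] :
    stdJ l R * (stdJ l R)ᵀ = 1 := by
  simp [stdJ, Matrix.fromBlocks_transpose, Matrix.fromBlocks_multiply]

theorem stdJ_map {l R S : Type*} [DecidableEq l] [CommRing R] [CommRing S] (f : R →+* S) :
    (stdJ l R).map f = stdJ l S := by
  simp [stdJ, Matrix.fromBlocks_map, Matrix.map_neg]

/-- The skew-hermitian form `αᵀ J (τ α)`. -/
def skewForm {l S : Type*} [Fintype l] [DecidableEq l] [CommRing S] (τ : S → S)
    (α : l ⊕ l → S) : S :=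
  α ⬝ᵥ (stdJ l S *ᵥ fun i => τ (α i))

theorem skewForm_eq_sum {l S : Type*} [Fintype l] [DecidableEq l] [CommRing S] (τ : S → S)
    (α : l ⊕ l → S) :
    skewForm τ α =
      ∑ i, (α (Sum.inl i) * τ (α (Sum.inr i)) - α (Sum.inr i) * τ (α (Sum.inl i))) := by
  simp [skewForm, stdJ, dotProduct, Matrix.fromBlocks_mulVec, Fintype.sum_sum_type,
    Matrix.neg_mulVec, Finset.sum_add_distrib, sub_eq_add_neg]

theorem map_skewForm {l R S : Type*} [Fintype l] [DecidableEq l] [CommRing R] [CommRing S]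
    [Algebra R S] (τ : S ≃ₐ[R] S) (hττ : ∀ s, τ (τ s) = s) (α : l ⊕ l → S) :
    τ (skewForm τ α) = -skewForm τ α := by
  simp only [skewForm_eq_sum, map_sum, map_sub, map_mul, hττ, ← Finset.sum_neg_distrib]
  exact Finset.sum_congr rfl fun i _ => by ring

theorem skewForm_smul {l R S : Type*} [Fintype l] [DecidableEq l] [CommRing R] [CommRing S]
    [Algebra R S] (τ : S ≃ₐ[R] S) (x : S) (α : l ⊕ l → S) :
    skewForm τ (x • α) = x * τ x * skewForm τ α := by
  simp only [skewForm_eq_sum, Pi.smul_apply, smul_eq_mul, map_mul, Finset.mul_sum]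
  exact Finset.sum_congr rfl fun i _ => by ring

theorem skewForm_mulVec {l R S : Type*} [Fintype l] [DecidableEq l] [CommRing R] [CommRing S]
    [Algebra R S] (τ : S ≃ₐ[R] S) {g : Matrix (l ⊕ l) (l ⊕ l) R} (hg : g ∈ symplecticGroup l R)
    (α : l ⊕ l → S) :
    skewForm τ (g.map (algebraMap R S) *ᵥ α) = skewForm τ α := by
  have h1 : (fun i => τ ((g.map (algebraMap R S) *ᵥ α) i)) =
      g.map (algebraMap R S) *ᵥ fun i => τ (α i) := by
    ext i
    simp [Matrix.mulVec, dotProduct]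
  have h2 : gᵀ * stdJ l R * g = stdJ l R := by
    have := mem_symplecticGroup_iff_stdJ.1 (SymplecticGroup.transpose_mem hg)
    rwa [transpose_transpose] at this
  have h3 := congr_arg (fun A => A.map (algebraMap R S)) h2
  simp only [Matrix.map_mul, stdJ_map] at h3
  rw [skewForm, h1, Matrix.mulVec_mulVec, ← Matrix.vecMul_transpose, ← Matrix.dotProduct_mulVec,
    Matrix.mulVec_mulVec, ← Matrix.transpose_map, ← Matrix.mul_assoc, h3, skewForm]

section Eigenvectors

variable {R S F L ι : Type*} [CommRing R]
  [CommRing S] [Field F] [Field L] [Algebra R S] [Algebra R F]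
  [Algebra R L] [Algebra S L] [Algebra F L] [IsScalarTower R F L] [IsScalarTower R S L]
  [Fintype ι]

/-- The `R`-span of an eigenvector with eigenvalue `ξ` is an ideal of `R[ξ]`. -/
theorem exists_ideal_of_mulVec {ξ : S} (hξ : Algebra.adjoin R {ξ} = ⊤)
    {Y : Matrix ι ι R} {α : ι → S} (hY : Y.map (algebraMap R S) *ᵥ α = ξ • α) :
    ∃ I : Ideal S, I.restrictScalars R = Submodule.span R (Set.range α) := by
  have key : ∀ s : S, ∀ x ∈ Submodule.span R (Set.range α), s * x ∈
      Submodule.span R (Set.range α) := by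
    intro s
    have hs : s ∈ Algebra.adjoin R {ξ} := hξ ▸ Algebra.mem_top
    induction hs using Algebra.adjoin_induction with
    | mem x hx =>
      rw [Set.mem_singleton_iff.1 hx]
      intro y hy
      induction hy using Submodule.span_induction with
      | mem y hy =>
        obtain ⟨i, rfl⟩ := hy
        have h1 := congr_fun hY i
        rw [Pi.smul_apply, smul_eq_mul] at h1
        rw [← h1]
        simp only [Matrix.mulVec, dotProduct, Matrix.map_apply, ← Algebra.smul_def]
        exact Submodule.sum_mem _ fun k _ =>
          Submodule.smul_mem _ _ (Submodule.subset_span ⟨k, rfl⟩)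
      | zero => simp
      | add a b _ _ ha hb => rw [mul_add]; exact Submodule.add_mem _ ha hb
      | smul r a _ ha => rw [mul_smul_comm]; exact Submodule.smul_mem _ _ ha
    | algebraMap r => intro x hx; rw [← Algebra.smul_def]; exact Submodule.smul_mem _ _ hx
    | add a b _ _ ha hb =>
      intro x hx; rw [add_mul]; exact Submodule.add_mem _ (ha x hx) (hb x hx)
    | mul a b _ _ ha hb => intro x hx; rw [mul_assoc]; exact ha _ (hb x hx)
  exact ⟨{ Submodule.span R (Set.range α) with smul_mem' := fun s x hx => key s x hx }, rfl⟩

theorem mul_eq_sum_of_mulVec (F L : Type*) [Field F] [Field L] [Algebra R F] [Algebra R L]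
    [Algebra S L] [Algebra F L] [IsScalarTower R F L] [IsScalarTower R S L] {ξ : S}
    {Y : Matrix ι ι R} {α : ι → S} (hY : Y.map (algebraMap R S) *ᵥ α = ξ • α) (i : ι) :
    algebraMap S L ξ * algebraMap S L (α i) =
      ∑ j, (Y.map (algebraMap R F)) i j • algebraMap S L (α j) := by
  have h := congr_arg (algebraMap S L) (congr_fun hY i)
  simp only [Matrix.mulVec, dotProduct, Matrix.map_apply, Pi.smul_apply, smul_eq_mul, map_sum,
    map_mul, ← IsScalarTower.algebraMap_apply] at h
  rw [← h]
  simp only [Matrix.map_apply, Algebra.smul_def, ← IsScalarTower.algebraMap_apply]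

theorem eq_of_mulVec_eq [IsFractionRing R F] {α : ι → S} {b : Basis ι F L} (hb : ∀ i, b i = algebraMap S L (α i))
    {A B : Matrix ι ι R} (h : A.map (algebraMap R S) *ᵥ α = B.map (algebraMap R S) *ᵥ α) :
    A = B := by
  ext i j
  apply IsFractionRing.injective R F
  have h1 := congr_arg (algebraMap S L) (congr_fun h i)
  simp only [Matrix.mulVec, dotProduct, Matrix.map_apply, map_sum,
    map_mul, ← IsScalarTower.algebraMap_apply] at h1
  have h2 : ∀ C : Matrix ι ι R, ∑ k, algebraMap R L (C i k) * algebraMap S L (α k) =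
      ∑ k, algebraMap R F (C i k) • b k := fun C =>
    Finset.sum_congr rfl fun k _ => by
      rw [hb, Algebra.smul_def, ← IsScalarTower.algebraMap_apply]
  rw [h2, h2] at h1
  have h3 := congr_arg (fun x => b.repr x j) h1
  simpa only [b.repr_sum_self] using h3

theorem pow_eq_one_of_mulVec [IsFractionRing R F] [DecidableEq ι] {ξ : S} {p : ℕ} (hξ : ξ ^ p = 1)
    {Y : Matrix ι ι R} {α : ι → S} {b : Basis ι F L} (hb : ∀ i, b i = algebraMap S L (α i))
    (hY : Y.map (algebraMap R S) *ᵥ α = ξ • α) : Y ^ p = 1 := by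
  have hpow : ∀ k : ℕ, (Y ^ k).map (algebraMap R S) *ᵥ α = ξ ^ k • α := by
    intro k
    induction k with
    | zero => simp [Matrix.map_one]
    | succ k ih =>
      rw [pow_succ, Matrix.map_mul, ← Matrix.mulVec_mulVec, hY, Matrix.mulVec_smul, ih, smul_smul,
        pow_succ, mul_comm]
  apply eq_of_mulVec_eq hb
  rw [hpow, hξ, one_smul, Matrix.map_one _ (map_zero _) (map_one _), Matrix.one_mulVec]

theorem ne_one_of_mulVec [IsDomain S] [DecidableEq ι] {ξ : S} (hξ : ξ ≠ 1) {Y : Matrix ι ι R} {α : ι → S}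
    (hα : α ≠ 0) (hY : Y.map (algebraMap R S) *ᵥ α = ξ • α) : Y ≠ 1 := by
  rintro rfl
  rw [Matrix.map_one _ (map_zero _) (map_one _), Matrix.one_mulVec] at hY
  obtain ⟨i, hi⟩ := Function.ne_iff.1 hα
  have h1 : α i = ξ * α i := congr_fun hY i
  exact hξ (mul_right_cancel₀ hi (by rw [← h1, one_mul]))

theorem sub_one_mul_aeval_derivative_cyclotomic {p : ℕ} [Fact p.Prime] {ξ : S}
    (hξ : Polynomial.aeval ξ (Polynomial.cyclotomic p R) = 0) :
    (ξ - 1) * Polynomial.aeval ξ (Polynomial.derivative (Polynomial.cyclotomic p R)) =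
      p * ξ ^ (p - 1) := by
  have h := congr_arg (fun f => Polynomial.aeval ξ (Polynomial.derivative f))
    (Polynomial.cyclotomic_prime_mul_X_sub_one R p)
  simp only [Polynomial.derivative_mul, Polynomial.derivative_X,
    Polynomial.derivative_one, Polynomial.derivative_X_pow, map_add, map_mul, map_sub, hξ,
    Polynomial.aeval_X, map_one, map_pow, map_zero, map_natCast] at h
  linear_combination h

variable [IsDomain S] [IsFractionRing S L]

theorem exists_basis_of_mulVec {ξ : S} (hξ : Algebra.adjoin F {algebraMap S L ξ} = ⊤)
    (hcard : Fintype.card ι = finrank F L)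
    {Y : Matrix ι ι R} {α : ι → S} (hα : α ≠ 0) (hY : Y.map (algebraMap R S) *ᵥ α = ξ • α) :
    ∃ b : Basis ι F L, ∀ i, b i = algebraMap S L (α i) := by
  have hα' : (fun i => algebraMap S L (α i)) ≠ 0 := fun h => hα <| funext fun i =>
    IsFractionRing.injective S L (by simpa using congr_fun h i)
  have hY' := mul_eq_sum_of_mulVec F L hY
  refine ⟨Basis.mk (linearIndependent_of_mulVec hξ hcard hα' hY')
    (span_eq_top_of_mulVec hξ hα' hY').ge, fun i => ?_⟩
  rw [Basis.mk_apply]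

/-- Two eigenvectors for the eigenvalue `ξ` are proportional. -/
theorem exists_smul_eq_smul_of_mulVec {ξ : S} (hξ : Algebra.adjoin F {algebraMap S L ξ} = ⊤)
    (hcard : Fintype.card ι = finrank F L)
    {Y : Matrix ι ι R} {α β : ι → S} (hα : α ≠ 0) (hY : Y.map (algebraMap R S) *ᵥ α = ξ • α)
    (hβ : β ≠ 0) (hY' : Y.map (algebraMap R S) *ᵥ β = ξ • β) :
    ∃ x y : S, x ≠ 0 ∧ y ≠ 0 ∧ x • α = y • β := by
  obtain ⟨b, hb⟩ := exists_basis_of_mulVec hξ hcard hα hY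
  obtain ⟨b', hb'⟩ := exists_basis_of_mulVec hξ hcard hβ hY'
  obtain ⟨i, -⟩ := Function.ne_iff.1 hα
  have h1 : α i ≠ 0 := fun h => b.ne_zero i (by rw [hb, h, map_zero])
  have h2 : β i ≠ 0 := fun h => b'.ne_zero i (by rw [hb', h, map_zero])
  refine ⟨β i, α i, h2, h1, sub_eq_zero.1 ?_⟩
  by_contra h
  obtain ⟨b'', hb''⟩ := exists_basis_of_mulVec (Y := Y) hξ hcard h (by
    rw [Matrix.mulVec_sub, Matrix.mulVec_smul, Matrix.mulVec_smul, hY, hY', smul_sub,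
      smul_comm, smul_comm (α i)])
  refine b''.ne_zero i ?_
  rw [hb'', Pi.sub_apply, Pi.smul_apply, Pi.smul_apply, smul_eq_mul, smul_eq_mul, mul_comm,
    sub_self, map_zero]

/-- A matrix of prime order `p` has an eigenvector whose eigenvalue is a given primitive `p`-th root
of unity. -/
theorem exists_mulVec_eq_smul [IsFractionRing R F] [FiniteDimensional F L] [DecidableEq ι]
    {p : ℕ} [Fact p.Prime] {ξ : S}
    (hξ : minpoly F (algebraMap S L ξ) = Polynomial.cyclotomic p F)
    {Y : Matrix ι ι R} (hY1 : Y ≠ 1) (hYp : Y ^ p = 1) :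
    ∃ α : ι → S, α ≠ 0 ∧ Y.map (algebraMap R S) *ᵥ α = ξ • α := by
  set A : Matrix ι ι F := Y.map (algebraMap R F) with hA
  have hAp : A ^ p = 1 := by
    have := congr_arg (algebraMap R F).mapMatrix hYp
    rwa [map_pow, map_one] at this
  have hA1 : A ≠ 1 := fun h => hY1 <| by
    refine Matrix.map_injective (IsFractionRing.injective R F) ?_
    simpa [Matrix.map_one] using h
  have hirr : Irreducible (minpoly F (algebraMap S L ξ)) :=
    minpoly.irreducible (Algebra.IsIntegral.isIntegral _)
  have hdvd : minpoly F (algebraMap S L ξ) ∣ A.charpoly := by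
    refine dvd_trans ?_ (Matrix.minpoly_dvd_charpoly A)
    by_contra h
    have hcop := (hirr.coprime_iff_not_dvd.2 h).symm
    have h1 : minpoly F A ∣ Polynomial.cyclotomic p F * (Polynomial.X - 1) := by
      rw [Polynomial.cyclotomic_prime_mul_X_sub_one]
      refine minpoly.dvd F A ?_
      simp [hAp]
    rw [hξ] at hcop
    have h2 := hcop.dvd_of_dvd_mul_left h1
    refine hA1 (sub_eq_zero.1 ?_)
    have h3 := Polynomial.aeval_eq_zero_of_dvd_aeval_eq_zero h2 (minpoly.aeval F A)
    simpa using h3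
  have hroot : Polynomial.aeval ξ Y.charpoly = 0 := by
    apply IsFractionRing.injective S L
    rw [map_zero, ← Polynomial.aeval_algebraMap_apply, ← Polynomial.aeval_map_algebraMap F,
      ← Matrix.charpoly_map]
    exact Polynomial.aeval_eq_zero_of_dvd_aeval_eq_zero hdvd (minpoly.aeval F _)
  have hdet : (Matrix.scalar ι ξ - Y.map (algebraMap R S)).det = 0 := by
    rw [← Matrix.eval_charpoly, Matrix.charpoly_map, Polynomial.eval_map_algebraMap, hroot]
  obtain ⟨α, hα, h⟩ := Matrix.exists_mulVec_eq_zero_iff.2 hdet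
  refine ⟨α, hα, ?_⟩
  rw [Matrix.sub_mulVec, sub_eq_zero] at h
  rw [← h]
  ext i
  simp [Matrix.scalar_apply, Matrix.mulVec_diagonal]

end Eigenvectors

section Pairs

open scoped nonZeroDivisors
open FractionalIdeal

variable {R S F L : Type*} [CommRing R] [CommRing S] [Field F] [Field L] [Algebra R S] [Algebra R F]
  [Algebra R L] [Algebra S L] [Algebra F L] [IsScalarTower R F L] [IsScalarTower R S L]
  {m : ℕ}

theorem gram_mulVec (τ : S ≃ₐ[R] S) {M g : Matrix (Fin m ⊕ Fin m) (Fin m ⊕ Fin m) R}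
    {α : Fin m ⊕ Fin m → S} {c : L}
    (hα : ∀ i j, Algebra.trace F L (c * algebraMap S L (α i) * algebraMap S L (τ (α j))) =
      algebraMap R F (M i j)) (i j : Fin m ⊕ Fin m) :
    Algebra.trace F L (c * algebraMap S L ((g.map (algebraMap R S) *ᵥ α) i) *
      algebraMap S L (τ ((g.map (algebraMap R S) *ᵥ α) j))) =
      algebraMap R F ((g * M * gᵀ) i j) := by
  have h1 : ∀ k l, Algebra.trace F L (c * (algebraMap R L (g i k) * algebraMap S L (α k)) *
      (algebraMap R L (g j l) * algebraMap S L (τ (α l)))) =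
      algebraMap R F (g i k * M k l * g j l) := fun k l => by
    have : c * (algebraMap R L (g i k) * algebraMap S L (α k)) *
        (algebraMap R L (g j l) * algebraMap S L (τ (α l))) =
        (algebraMap R F (g i k * g j l)) •
          (c * algebraMap S L (α k) * algebraMap S L (τ (α l))) := by
      rw [Algebra.smul_def, ← IsScalarTower.algebraMap_apply, map_mul]
      ring
    rw [this, map_smul, hα, smul_eq_mul, ← map_mul]
    congr 1
    ring
  simp only [Matrix.mulVec, dotProduct, Matrix.map_apply, map_sum, map_mul, AlgEquiv.commutes,
    ← IsScalarTower.algebraMap_apply, Matrix.mul_apply, Matrix.transpose_apply, Finset.mul_sum,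
    Finset.sum_mul] at h1 ⊢
  exact Finset.sum_congr rfl fun k _ => Finset.sum_congr rfl fun l _ => h1 _ _

variable [IsFractionRing R F] [IsFractionRing S L] [FiniteDimensional F L]
  [Algebra.IsSeparable F L]

theorem mul_skewForm_eq_one (τ : S ≃ₐ[R] S) {α : Fin m ⊕ Fin m → S}
    (b : Basis (Fin m ⊕ Fin m) F L) (hb : ∀ i, b i = algebraMap S L (α i)) {c : L}
    (hc : ∀ i j, Algebra.trace F L (c * algebraMap S L (α i) * algebraMap S L (τ (α j))) =
      algebraMap R F (stdJ (Fin m) R i j)) :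
    c * algebraMap S L (skewForm τ α) = 1 := by
  set σ : L ≃ₐ[F] L := IsFractionRing.fieldEquivOfAlgEquiv F L L τ with hσ
  have hσ' : ∀ s, σ (algebraMap S L s) = algebraMap S L (τ s) := fun s =>
    IsFractionRing.fieldEquivOfAlgEquiv_algebraMap F L L τ s
  rw [← mul_dotProduct_eq_one σ b (stdJ_mul_transpose (Fin m) F) fun i j => by
    rw [hb, hb, hσ', hc, ← stdJ_map (algebraMap R F), Matrix.map_apply]]
  congr 1
  rw [stdJ_map, skewForm, RingHom.map_dotProduct]
  congr 1
  · exact (funext hb).symm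
  · ext i
    rw [Function.comp_apply, RingHom.map_mulVec, stdJ_map]
    simp only [hb, hσ']
    rfl

/-- The Gram matrix of the hermitian trace form of an eigenvector of a symplectic matrix. -/
theorem gram_of_mulVec {ξ : S}
    (hξ : Algebra.adjoin F {algebraMap S L ξ} = ⊤) (τ : S ≃ₐ[R] S) (hτ : τ ξ * ξ = 1)
    {Y : Matrix (Fin m ⊕ Fin m) (Fin m ⊕ Fin m) R} (hY : Y ∈ symplecticGroup (Fin m) R)
    {α : Fin m ⊕ Fin m → S} (hα : Y.map (algebraMap R S) *ᵥ α = ξ • α)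
    (b : Basis (Fin m ⊕ Fin m) F L) (hb : ∀ i, b i = algebraMap S L (α i)) :
    skewForm τ α ≠ 0 ∧ ∀ i j, Algebra.trace F L ((algebraMap S L (skewForm τ α))⁻¹ *
      algebraMap S L (α i) * algebraMap S L (τ (α j))) = algebraMap R F (stdJ (Fin m) R i j) := by
  set σ : L ≃ₐ[F] L := IsFractionRing.fieldEquivOfAlgEquiv F L L τ with hσ
  have hσ' : ∀ s, σ (algebraMap S L s) = algebraMap S L (τ s) := fun s =>
    IsFractionRing.fieldEquivOfAlgEquiv_algebraMap F L L τ s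
  have hinv : (Y.map (algebraMap R F)) * stdJ (Fin m) F * (Y.map (algebraMap R F))ᵀ =
      stdJ (Fin m) F := by
    have := congr_arg (fun A => A.map (algebraMap R F)) (mem_symplecticGroup_iff_stdJ.1 hY)
    simpa only [Matrix.map_mul, stdJ_map, ← Matrix.transpose_map] using this
  obtain ⟨c, hc⟩ := exists_trace_eq_of_invariant hξ σ
    (by rw [hσ', ← map_mul, hτ, map_one]) b hinv (fun i => by
      simpa only [hb] using mul_eq_sum_of_mulVec F L hα i)
  have hc1 : ∀ i j, Algebra.trace F L (c * algebraMap S L (α i) * algebraMap S L (τ (α j))) =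
      algebraMap R F (stdJ (Fin m) R i j) := fun i j => by
    rw [← hb, ← hσ', ← hb, hc, ← stdJ_map (algebraMap R F), Matrix.map_apply]
  have h1 := mul_skewForm_eq_one τ b hb hc1
  refine ⟨fun h => by simp [h] at h1, ?_⟩
  rwa [← eq_inv_of_mul_eq_one_left h1]

/-- Eigenvectors with the same span and the same value of the skew-hermitian form come from
conjugate symplectic matrices. -/
theorem exists_conj_of_mulVec [IsDomain S] {ξ : S}
    (hξ : Algebra.adjoin F {algebraMap S L ξ} = ⊤) (hm : finrank F L = m + m)
    (τ : S ≃ₐ[R] S) (hτ : τ ξ * ξ = 1)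
    {Y Y' : Matrix (Fin m ⊕ Fin m) (Fin m ⊕ Fin m) R} (hY : Y ∈ symplecticGroup (Fin m) R)
    (hY' : Y' ∈ symplecticGroup (Fin m) R) {α α' : Fin m ⊕ Fin m → S} (hα0 : α ≠ 0)
    (hα : Y.map (algebraMap R S) *ᵥ α = ξ • α) (hα0' : α' ≠ 0)
    (hα' : Y'.map (algebraMap R S) *ᵥ α' = ξ • α')
    (hspan : Submodule.span R (Set.range α) = Submodule.span R (Set.range α'))
    (hform : skewForm τ α = skewForm τ α') :
    ∃ g ∈ symplecticGroup (Fin m) R, g * Y = Y' * g := by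
  have hcard : Fintype.card (Fin m ⊕ Fin m) = finrank F L := by simp [hm]
  obtain ⟨b, hb⟩ := exists_basis_of_mulVec hξ hcard hα0 hα
  obtain ⟨b', hb'⟩ := exists_basis_of_mulVec hξ hcard hα0' hα'
  have hg : ∀ i, ∃ r : Fin m ⊕ Fin m → R, ∑ j, r j • α j = α' i := fun i =>
    (Submodule.mem_span_range_iff_exists_fun R).1 (hspan ▸ Submodule.subset_span ⟨i, rfl⟩)
  choose g hg using hg
  have hgα : (Matrix.of g).map (algebraMap R S) *ᵥ α = α' := by
    ext i
    simp only [← hg, Matrix.mulVec, dotProduct, Matrix.map_apply, Matrix.of_apply,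
      Algebra.smul_def]
  have h1 := (gram_of_mulVec hξ τ hτ hY hα b hb).2
  have h2 := (gram_of_mulVec hξ τ hτ hY' hα' b' hb').2
  have h3 := gram_mulVec (g := Matrix.of g) τ h1
  rw [hgα, hform] at h3
  refine ⟨Matrix.of g, mem_symplecticGroup_iff_stdJ.2 ?_, ?_⟩
  · ext i j
    apply IsFractionRing.injective R F
    rw [← h3, h2]
  · apply eq_of_mulVec_eq hb
    rw [Matrix.map_mul, Matrix.map_mul, ← Matrix.mulVec_mulVec, ← Matrix.mulVec_mulVec, hgα, hα,
      hα', Matrix.mulVec_smul, hgα]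

variable [IsDomain R] [IsDedekindDomain S] [IsIntegrallyClosed R] [IsIntegralClosure S R L]

/-- The ideal spanned by an eigenvector of a symplectic matrix, times its conjugate, is
principal. -/
theorem exists_gen_of_mulVec {ξ : S}
    (hξ : Algebra.adjoin F {algebraMap S L ξ} = ⊤) (hm : finrank F L = m + m)
    (τ : S ≃ₐ[R] S) (hτ : τ ξ * ξ = 1) {D : S} (hD0 : D ≠ 0)
    (hD : dual R F (1 : FractionalIdeal S⁰ L) = spanSingleton S⁰ (algebraMap S L D)⁻¹)
    {Y : Matrix (Fin m ⊕ Fin m) (Fin m ⊕ Fin m) R} (hY : Y ∈ symplecticGroup (Fin m) R)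
    {α : Fin m ⊕ Fin m → S} (hα0 : α ≠ 0)
    (hα : Y.map (algebraMap R S) *ᵥ α = ξ • α) {I : Ideal S}
    (hI : I.restrictScalars R = Submodule.span R (Set.range α)) :
    ∃ a : S, a ≠ 0 ∧ skewForm τ α = D * a ∧ I * I.map τ = Ideal.span {a} := by
  have hcard : Fintype.card (Fin m ⊕ Fin m) = finrank F L := by simp [hm]
  obtain ⟨b, hb⟩ := exists_basis_of_mulVec hξ hcard hα0 hα
  obtain ⟨h0, hgram⟩ := gram_of_mulVec hξ τ hτ hY hα b hb
  have hI0 : I ≠ ⊥ := by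
    rintro rfl
    obtain ⟨i, hi⟩ := Function.ne_iff.1 hα0
    have : α i ∈ (⊥ : Ideal S).restrictScalars R := hI ▸ Submodule.subset_span ⟨i, rfl⟩
    exact hi this
  set σ : L ≃ₐ[F] L := IsFractionRing.fieldEquivOfAlgEquiv F L L τ with hσ
  have hσ' : ∀ s, σ (algebraMap S L s) = algebraMap S L (τ s) := fun s =>
    IsFractionRing.fieldEquivOfAlgEquiv_algebraMap F L L τ s
  have h1 := dual_coeIdeal_eq_of_gram hI0 hI b hb τ σ hσ' (stdJ_mul_transpose (Fin m) R)
    (c := (algebraMap S L (skewForm τ α))⁻¹) (fun i j => by rw [hb, hb, hσ', hgram])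
  rw [dual_coeIdeal_eq_iff hI0 hD] at h1
  have hD0' : algebraMap S L D ≠ 0 := by simpa using hD0
  have h0' : algebraMap S L (skewForm τ α) ≠ 0 := by simpa using h0
  have h2 : ((I * I.map τ : Ideal S) : FractionalIdeal S⁰ L) =
      spanSingleton S⁰ (algebraMap S L (skewForm τ α) * (algebraMap S L D)⁻¹) := by
    rw [← spanSingleton_mul_spanSingleton, ← h1, ← mul_assoc, spanSingleton_mul_spanSingleton,
      mul_inv_cancel₀ h0', spanSingleton_one, one_mul]
  obtain ⟨a, -, ha⟩ : ∃ a ∈ I * I.map τ,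
      algebraMap S L a = algebraMap S L (skewForm τ α) * (algebraMap S L D)⁻¹ := by
    rw [← mem_coeIdeal S⁰, h2]
    exact mem_spanSingleton_self _ _
  have ha' : skewForm τ α = D * a := by
    apply IsFractionRing.injective S L
    rw [map_mul, ha, mul_comm, inv_mul_cancel_right₀ hD0']
  refine ⟨a, fun h => h0 (by rw [ha', h, mul_zero]), ha', ?_⟩
  apply coeIdeal_injective (K := L)
  beta_reduce
  rw [h2, coeIdeal_span_singleton, ha]

end Pairs

section SymplecticMatrixOfIdeal

open scoped nonZeroDivisors
open FractionalIdeal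

variable {R S F L : Type*} [CommRing R] [CommRing S] [Field F] [Field L] [Algebra R S] [Algebra R F]
  [Algebra R L] [Algebra S L] [Algebra F L] [IsScalarTower R F L] [IsScalarTower R S L]
  [IsFractionRing R F] [IsFractionRing S L]

/-- An `R`-basis of a nonzero ideal of `R[ξ]` is a basis of the fraction field. -/
theorem exists_basis_of_ideal [IsDomain R] {ξ : S} (hξ : Algebra.adjoin F {algebraMap S L ξ} = ⊤)
    {I : Ideal S} (hI : I ≠ ⊥) {κ : Type*} (v : Basis κ R I) :
    ∃ b : Basis κ F L, ∀ k, b k = algebraMap S L (v k) := by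
  have hinj : Function.Injective ((IsScalarTower.toAlgHom R S L).toLinearMap ∘ₗ
      (I.subtype.restrictScalars R)) :=
    (IsFractionRing.injective S L).comp Subtype.val_injective
  have hli : LinearIndependent F fun k => algebraMap S L (v k) := by
    rw [← LinearIndependent.iff_fractionRing R F]
    exact v.linearIndependent.map' _ (LinearMap.ker_eq_bot.2 hinj)
  have hmem : ∀ x ∈ I, algebraMap S L x ∈
      Submodule.span F (Set.range fun k => algebraMap S L (v k)) := by
    intro x hx
    have h : (⟨x, hx⟩ : I) ∈ Submodule.span R (Set.range v) := v.span_eq ▸ Submodule.mem_top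
    have key : ∀ y ∈ Submodule.span R (Set.range v), algebraMap S L (y : S) ∈
        Submodule.span F (Set.range fun k => algebraMap S L (v k)) := by
      intro y hy
      induction hy using Submodule.span_induction with
      | mem y hy => obtain ⟨k, rfl⟩ := hy; exact Submodule.subset_span ⟨k, rfl⟩
      | zero => simp
      | add y z _ _ hy hz =>
        rw [Submodule.coe_add, map_add]; exact Submodule.add_mem _ hy hz
      | smul r y _ hy =>
        rw [Submodule.coe_smul_of_tower, Algebra.smul_def, map_mul,
          ← IsScalarTower.algebraMap_apply, IsScalarTower.algebraMap_apply R F L,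
          ← Algebra.smul_def]
        exact Submodule.smul_mem _ _ hy
    exact key _ h
  obtain ⟨x, hx, hx0⟩ := Submodule.exists_mem_ne_zero_of_ne_bot hI
  have htop := eq_top_of_mul_mem hξ (Submodule.span F (Set.range fun k => algebraMap S L (v k)))
    (fun y hy => by
      induction hy using Submodule.span_induction with
      | mem y hy =>
        obtain ⟨k, rfl⟩ := hy
        rw [← map_mul]
        exact hmem _ (I.mul_mem_left _ (v k).2)
      | zero => simp
      | add y z _ _ hy hz => rw [mul_add]; exact Submodule.add_mem _ hy hz
      | smul r y _ hy => rw [mul_smul_comm]; exact Submodule.smul_mem _ _ hy)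
    (hmem x hx) (by simpa using hx0)
  exact ⟨Basis.mk hli htop.ge, fun k => by rw [Basis.mk_apply]⟩

variable [FiniteDimensional F L] [Algebra.IsSeparable F L] [IsDomain R] [IsDedekindDomain S]
  [IsPrincipalIdealRing R] [IsIntegralClosure S R L]

/-- The hermitian trace form on an ideal `I` with `I * conj I = (a)` is a unimodular alternating
form. -/
theorem exists_unimodular_form [CharZero F] {ξ : S}
    (hξ : Algebra.adjoin F {algebraMap S L ξ} = ⊤)
    (τ : S ≃ₐ[R] S) (hττ : ∀ s, τ (τ s) = s) {D : S}
    (hDτ : τ D = -D)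
    (hD : dual R F (1 : FractionalIdeal S⁰ L) = spanSingleton S⁰ (algebraMap S L D)⁻¹)
    {I : Ideal S} {a : S} (ha0 : a ≠ 0) (haτ : τ a = a) (hI : I * I.map τ = Ideal.span {a})
    {κ : Type*} (v : Basis κ R I) :
    ∃ B : I →ₗ[R] I →ₗ[R] R, (∀ x y : I, Algebra.trace F L ((algebraMap S L (D * a))⁻¹ *
        algebraMap S L x * algebraMap S L (τ y)) = algebraMap R F (B x y)) ∧
      (∀ x, B x x = 0) ∧ Function.Surjective B := by
  have hI0 : I ≠ ⊥ := by
    rintro rfl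
    rw [Ideal.bot_mul, eq_comm, Ideal.span_singleton_eq_bot] at hI
    exact ha0 hI
  have hI0' : (I : FractionalIdeal S⁰ L) ≠ 0 := coeIdeal_ne_zero.2 hI0
  set c := (algebraMap S L (D * a))⁻¹ with hc
  have ha' : algebraMap S L a ≠ 0 := by simpa using ha0
  set σ : L ≃ₐ[F] L := IsFractionRing.fieldEquivOfAlgEquiv F L L τ with hσ
  have hσ' : ∀ s, σ (algebraMap S L s) = algebraMap S L (τ s) := fun s =>
    IsFractionRing.fieldEquivOfAlgEquiv_algebraMap F L L τ s
  have hdual : dual R F (I : FractionalIdeal S⁰ L) =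
      spanSingleton S⁰ c * ((I.map τ : Ideal S) : FractionalIdeal S⁰ L) := by
    rw [dual_coeIdeal_eq_iff hI0 hD, hI, coeIdeal_span_singleton,
      spanSingleton_mul_spanSingleton, hc, map_mul, mul_inv, inv_mul_cancel_right₀ ha']
  have hex : ∀ x y : I, ∃ r : R, algebraMap R F r =
      Algebra.trace F L (c * algebraMap S L x * algebraMap S L (τ y)) := by
    intro x y
    have h1 : c * algebraMap S L (τ y) ∈ dual R F (I : FractionalIdeal S⁰ L) := by
      rw [hdual, mem_singleton_mul]
      exact ⟨_, (mem_coeIdeal _).2 ⟨_, Ideal.mem_map_of_mem τ y.2, rfl⟩, rfl⟩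
    obtain ⟨r, hr⟩ := (mem_dual hI0').1 h1 (algebraMap S L x) ((mem_coeIdeal _).2 ⟨x, x.2, rfl⟩)
    refine ⟨r, hr.trans ?_⟩
    rw [Algebra.traceForm_apply]
    congr 1
    ring
  choose β hβ using hex
  have hinj := IsFractionRing.injective R F
  have hsmul : ∀ (r : R) (x : L), Algebra.trace F L (algebraMap R L r * x) =
      algebraMap R F r * Algebra.trace F L x := fun r x => by
    rw [IsScalarTower.algebraMap_apply R F L, ← Algebra.smul_def, map_smul, smul_eq_mul]
  have hcoe : ∀ (r : R) (x : I), algebraMap S L ((r • x : I) : S) =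
      algebraMap R L r * algebraMap S L x := fun r x => by
    rw [Submodule.coe_smul_of_tower, Algebra.smul_def, map_mul, ← IsScalarTower.algebraMap_apply]
  have hcoeτ : ∀ (r : R) (x : I), algebraMap S L (τ ((r • x : I) : S)) =
      algebraMap R L r * algebraMap S L (τ x) := fun r x => by
    rw [Submodule.coe_smul_of_tower, map_smul, Algebra.smul_def, map_mul,
      ← IsScalarTower.algebraMap_apply]
  let B : I →ₗ[R] I →ₗ[R] R := LinearMap.mk₂ R β
    (fun x x' y => hinj <| by
      rw [hβ, map_add, hβ, hβ, ← map_add, Submodule.coe_add, map_add]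
      congr 1
      ring)
    (fun r x y => hinj <| by
      rw [hβ, hcoe, smul_eq_mul, map_mul (algebraMap R F), hβ, ← hsmul]
      congr 1
      ring)
    (fun x y y' => hinj <| by
      rw [hβ, map_add, hβ, hβ, ← map_add, Submodule.coe_add, map_add, map_add]
      congr 1
      ring)
    (fun r x y => hinj <| by
      rw [hβ, hcoeτ, smul_eq_mul, map_mul (algebraMap R F), hβ, ← hsmul]
      congr 1
      ring)
  have hB : ∀ x y : I, algebraMap R F (B x y) =
      Algebra.trace F L (c * algebraMap S L x * algebraMap S L (τ y)) := hβ
  have hskew : ∀ x y, B x y = -B y x := fun x y => hinj <| by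
    rw [map_neg, hB, hB, ← Algebra.trace_eq_of_algEquiv σ, ← map_neg]
    congr 1
    rw [hc, map_mul, map_mul, map_inv₀, hσ', hσ', hσ', hττ, map_mul, hDτ, haτ, neg_mul, map_neg,
      inv_neg]
    ring
  refine ⟨B, fun x y => (hB x y).symm, fun x => ?_, fun f => ?_⟩
  · have : CharZero R := (algebraMap R F).charZero
    exact self_eq_neg.1 (hskew x x)
  · obtain ⟨b, hb⟩ := exists_basis_of_ideal hξ hI0 v
    let fL : L →ₗ[F] F := b.constr F fun k => algebraMap R F (f (v k))
    have hfL : ∀ x : I, fL (algebraMap S L x) = algebraMap R F (f x) := by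
      let g₁ : I →ₗ[R] F := (fL.restrictScalars R) ∘ₗ (IsScalarTower.toAlgHom R S L).toLinearMap ∘ₗ
        (I.subtype.restrictScalars R)
      let g₂ : I →ₗ[R] F := (Algebra.linearMap R F) ∘ₗ f
      have : g₁ = g₂ := v.ext fun k => by
        change fL (algebraMap S L (v k)) = algebraMap R F (f (v k))
        rw [← hb, Basis.constr_basis]
      exact fun x => LinearMap.congr_fun this x
    obtain ⟨z, hz⟩ := ((Algebra.traceForm F L).toDual (traceForm_nondegenerate F L)).surjective fL
    have hz' : ∀ x, Algebra.trace F L (z * x) = fL x := fun x => by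
      have := LinearMap.congr_fun hz x
      rwa [LinearMap.BilinForm.toDual_def, Algebra.traceForm_apply] at this
    have hzmem : z ∈ dual R F (I : FractionalIdeal S⁰ L) := by
      rw [mem_dual hI0']
      intro y hy
      obtain ⟨x, hx, rfl⟩ := (mem_coeIdeal _).1 hy
      exact ⟨f ⟨x, hx⟩, by rw [Algebra.traceForm_apply, hz', ← hfL]⟩
    rw [hdual, mem_singleton_mul] at hzmem
    obtain ⟨y, hy, rfl⟩ := hzmem
    obtain ⟨s, hs, rfl⟩ := (mem_coeIdeal _).1 hy
    obtain ⟨t, ht, rfl⟩ := (Ideal.mem_map_of_equiv τ s).1 hs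
    refine ⟨-⟨t, ht⟩, LinearMap.ext fun x => hinj ?_⟩
    rw [map_neg, LinearMap.neg_apply, ← hskew, hB, ← hfL, ← hz']
    congr 1
    ring

/-- Every ideal `I` with `I * conj I = (a)` is spanned by an eigenvector of a symplectic matrix. -/
theorem exists_symplectic_mulVec [CharZero F] {ξ : S}
    (hξ : Algebra.adjoin F {algebraMap S L ξ} = ⊤) {m : ℕ} (hm : finrank F L = m + m)
    [Module.Finite R S] [IsTorsionFree R S]
    (τ : S ≃ₐ[R] S) (hτ : τ ξ * ξ = 1) (hττ : ∀ s, τ (τ s) = s) {D : S} (hD0 : D ≠ 0)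
    (hDτ : τ D = -D)
    (hD : dual R F (1 : FractionalIdeal S⁰ L) = spanSingleton S⁰ (algebraMap S L D)⁻¹)
    {I : Ideal S} {a : S} (ha0 : a ≠ 0) (haτ : τ a = a) (hI : I * I.map τ = Ideal.span {a}) :
    ∃ Y ∈ symplecticGroup (Fin m) R, ∃ α : Fin m ⊕ Fin m → S, α ≠ 0 ∧
      Y.map (algebraMap R S) *ᵥ α = ξ • α ∧
      I.restrictScalars R = Submodule.span R (Set.range α) ∧ skewForm τ α = D * a := by
  have hI0 : I ≠ ⊥ := by
    rintro rfl
    rw [Ideal.bot_mul, eq_comm, Ideal.span_singleton_eq_bot] at hI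
    exact ha0 hI
  have : Module.Finite R I := inferInstanceAs (Module.Finite R (I.restrictScalars R))
  have : IsTorsionFree R I := inferInstanceAs (IsTorsionFree R (I.restrictScalars R))
  have : Module.Free R I := Module.free_of_finite_type_torsion_free'
  let v := Module.Free.chooseBasis R I
  obtain ⟨B, hB, hBalt, hBs⟩ := exists_unimodular_form hξ τ hττ hDτ hD ha0 haτ hI v
  have hrank : finrank R I = m + m := by
    obtain ⟨b, -⟩ := exists_basis_of_ideal hξ hI0 v
    rw [finrank_eq_card_basis v, ← finrank_eq_card_basis b, hm]
  obtain ⟨w, hw⟩ := exists_symplectic_basis B hBalt hBs hrank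
  obtain ⟨b, hb⟩ := exists_basis_of_ideal hξ hI0 w
  let α : Fin m ⊕ Fin m → S := fun i => w i
  have hgram : ∀ i j, Algebra.trace F L ((algebraMap S L (D * a))⁻¹ * algebraMap S L (α i) *
      algebraMap S L (τ (α j))) = algebraMap R F (stdJ (Fin m) R i j) := fun i j => by
    rw [← hw, ← hB]
  let Y : Matrix (Fin m ⊕ Fin m) (Fin m ⊕ Fin m) R :=
    Matrix.of fun i j => w.repr ⟨ξ * α i, I.mul_mem_left ξ (w i).2⟩ j
  have hYα : Y.map (algebraMap R S) *ᵥ α = ξ • α := by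
    ext i
    have h := congr_arg (I.subtype.restrictScalars R)
      (w.sum_repr ⟨ξ * α i, I.mul_mem_left ξ (w i).2⟩)
    rw [map_sum] at h
    simpa [Matrix.mulVec, dotProduct, Y, Algebra.smul_def] using h
  have hgramY := gram_mulVec (g := Y) τ hgram
  have hYmem : Y ∈ symplecticGroup (Fin m) R := by
    refine mem_symplecticGroup_iff_stdJ.2 (Matrix.ext fun i j => ?_)
    apply IsFractionRing.injective R F
    rw [← hgramY, ← hgram, hYα, Pi.smul_apply, Pi.smul_apply, smul_eq_mul, smul_eq_mul]
    congr 1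
    have h1 : algebraMap S L (τ ξ) * algebraMap S L ξ = 1 := by rw [← map_mul, hτ, map_one]
    rw [map_mul (algebraMap S L) ξ, map_mul τ, map_mul (algebraMap S L) (τ ξ)]
    linear_combination (algebraMap S L (D * a))⁻¹ * algebraMap S L (α i) *
      algebraMap S L (τ (α j)) * h1
  have hα0 : α ≠ 0 := by
    intro h
    obtain ⟨i⟩ := b.index_nonempty
    exact b.ne_zero i (by rw [hb]; exact (congr_arg _ (congr_fun h i)).trans (map_zero _))
  have hspan : I.restrictScalars R = Submodule.span R (Set.range α) := by
    have h := congr_arg (Submodule.map (I.subtype.restrictScalars R)) w.span_eq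
    rw [Submodule.map_span, ← Set.range_comp, Submodule.map_top] at h
    rw [← show LinearMap.range (I.subtype.restrictScalars R) = I.restrictScalars R by
      ext; simp]
    exact h.symm
  refine ⟨Y, hYmem, α, hα0, hYα, hspan, IsFractionRing.injective S L ?_⟩
  have hDa : algebraMap S L (D * a) ≠ 0 := by simp [hD0, ha0]
  rw [← mul_one (algebraMap S L (D * a)), ← mul_skewForm_eq_one τ b hb hgram,
    mul_inv_cancel_left₀ hDa]

end SymplecticMatrixOfIdeal

open ComplexConjugate IntermediateField

theorem isLocalization_powers {A B : Type*} [CommRing A] [CommRing B] [Algebra A B]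
    (hinj : Function.Injective (algebraMap A B)) {x : A} (hx : IsUnit (algebraMap A B x))
    (h : ∀ b : B, ∃ (N : ℕ) (a : A), b * algebraMap A B x ^ N = algebraMap A B a) :
    IsLocalization (Submonoid.powers x) B := by
  rw [isLocalization_iff]
  refine ⟨?_, fun b => ?_, fun hab => ⟨1, by rw [hinj hab]⟩⟩
  · rintro ⟨_, N, rfl⟩
    simpa using hx.pow N
  · obtain ⟨N, a, hb⟩ := h b
    exact ⟨(a, ⟨x ^ N, N, rfl⟩), by simpa using hb⟩

theorem isPrincipalIdealRing_of_isLocalization {A : Type*} (B : Type*) [CommRing A] [CommRing B]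
    [Algebra A B] (M : Submonoid A) [IsLocalization M B] [IsPrincipalIdealRing A] :
    IsPrincipalIdealRing B where
  principal J := by
    obtain ⟨a, ha⟩ := (IsPrincipalIdealRing.principal (Ideal.under A J)).principal
    refine ⟨algebraMap A B a, ?_⟩
    rw [← IsLocalization.map_under M B J]
    change Ideal.map (algebraMap A B) _ = Ideal.span _
    rw [ha]
    exact (Ideal.map_span _ _).trans (by rw [Set.image_singleton])

section Coefficients

variable (n : ℤ)

theorem inv_mem_ZInv : ((n : ℂ))⁻¹ ∈ ZInv n := Algebra.subset_adjoin rfl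

theorem ZInv_mem_bot {x : ℂ} (hx : x ∈ ZInv n) : x ∈ (⊥ : Subalgebra ℚ ℂ) := by
  induction hx using Algebra.adjoin_induction with
  | mem x hx =>
    rw [Set.mem_singleton_iff.1 hx]
    exact ⟨(n : ℚ)⁻¹, by simp⟩
  | algebraMap z => exact ⟨z, by simp⟩
  | add x y _ _ hx hy => exact Subalgebra.add_mem _ hx hy
  | mul x y _ _ hx hy => exact Subalgebra.mul_mem _ hx hy

/-- `ℤ[1/n]` as a subring of `ℚ`. -/
noncomputable instance : Algebra (ZInv n) ℚ :=
  ((Algebra.botEquiv ℚ ℂ : (⊥ : Subalgebra ℚ ℂ) →+* ℚ).comp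
    ((ZInv n).val.toRingHom.codRestrict (⊥ : Subalgebra ℚ ℂ) fun x =>
      ZInv_mem_bot n x.2)).toAlgebra

instance : IsScalarTower (ZInv n) ℚ ℂ := IsScalarTower.of_algebraMap_eq fun x => by
  have h : ∀ y : (⊥ : Subalgebra ℚ ℂ), algebraMap ℚ ℂ (Algebra.botEquiv ℚ ℂ y) = y := fun y => by
    obtain ⟨q, rfl⟩ := (Algebra.botEquiv ℚ ℂ).symm.surjective y
    rw [AlgEquiv.apply_symm_apply, Algebra.botEquiv_symm_apply]
    rfl
  exact (h ⟨x, ZInv_mem_bot n x.2⟩).symm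

theorem conj_ZInv (r : ZInv n) : conj (algebraMap (ZInv n) ℂ r) = algebraMap (ZInv n) ℂ r := by
  rw [IsScalarTower.algebraMap_apply (ZInv n) ℚ ℂ, eq_ratCast, map_ratCast]

variable {n} (hn : n ≠ 0)
include hn

theorem exists_mul_pow_eq_intCast {x : ℂ} (hx : x ∈ ZInv n) :
    ∃ (N : ℕ) (z : ℤ), x * (n : ℂ) ^ N = z := by
  have hn' : (n : ℂ) ≠ 0 := by exact_mod_cast hn
  induction hx using Algebra.adjoin_induction with
  | mem x hx =>
    rw [Set.mem_singleton_iff.1 hx]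
    exact ⟨1, 1, by simp [hn']⟩
  | algebraMap z => exact ⟨0, z, by simp⟩
  | add x y _ _ hx hy =>
    obtain ⟨N, z, hx⟩ := hx
    obtain ⟨N', z', hy⟩ := hy
    refine ⟨N + N', z * n ^ N' + z' * n ^ N, ?_⟩
    push_cast
    rw [← hx, ← hy]
    ring
  | mul x y _ _ hx hy =>
    obtain ⟨N, z, hx⟩ := hx
    obtain ⟨N', z', hy⟩ := hy
    refine ⟨N + N', z * z', ?_⟩
    push_cast
    rw [← hx, ← hy]
    ring

theorem isLocalization_ZInv : IsLocalization (Submonoid.powers n) (ZInv n) := by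
  have hn' : (n : ℂ) ≠ 0 := by exact_mod_cast hn
  refine isLocalization_powers (fun a b h => ?_) ?_ fun b => ?_
  · have := congr_arg (fun x : ZInv n => (x : ℂ)) h
    simpa using this
  · refine IsUnit.of_mul_eq_one ⟨_, inv_mem_ZInv n⟩ ?_
    ext
    simp [hn']
  · obtain ⟨N, z, h⟩ := exists_mul_pow_eq_intCast hn b.2
    exact ⟨N, z, by ext; simpa using h⟩

theorem isPrincipalIdealRing_ZInv : IsPrincipalIdealRing (ZInv n) :=
  have := isLocalization_ZInv hn
  isPrincipalIdealRing_of_isLocalization (ZInv n) (Submonoid.powers n)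

theorem isFractionRing_ZInv : IsFractionRing (ZInv n) ℚ := by
  have := isLocalization_ZInv hn
  have : IsScalarTower ℤ (ZInv n) ℚ := IsScalarTower.of_algebraMap_eq' (RingHom.ext_int _ _)
  exact IsFractionRing.isFractionRing_of_isDomain_of_isLocalization (Submonoid.powers n)
    (ZInv n) ℚ

end Coefficients

section Cyclotomic

variable (n : ℤ) (ξ : ℂ)

theorem ZInvXi_mem_adjoin {x : ℂ} (hx : x ∈ ZInvXi n ξ) : x ∈ ℚ⟮ξ⟯ := by
  induction hx using Algebra.adjoin_induction with
  | mem x hx =>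
    rw [Set.mem_singleton_iff.1 hx]
    exact mem_adjoin_simple_self ℚ ξ
  | algebraMap r =>
    rw [IsScalarTower.algebraMap_apply (ZInv n) ℚ ℂ]
    exact IntermediateField.algebraMap_mem _ _
  | add x y _ _ hx hy => exact add_mem hx hy
  | mul x y _ _ hx hy => exact mul_mem hx hy

noncomputable instance : Algebra (ZInvXi n ξ) ℚ⟮ξ⟯ :=
  ((ZInvXi n ξ).val.toRingHom.codRestrict ℚ⟮ξ⟯.toSubalgebra fun x =>
    ZInvXi_mem_adjoin n ξ x.2).toAlgebra

@[simp]
theorem coe_algebraMap_adjoin (x : ZInvXi n ξ) :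
    ((algebraMap (ZInvXi n ξ) ℚ⟮ξ⟯ x : ℚ⟮ξ⟯) : ℂ) = x := rfl

instance : IsScalarTower (ZInv n) (ZInvXi n ξ) ℚ⟮ξ⟯ :=
  IsScalarTower.of_algebraMap_eq fun x => Subtype.ext <| by
    rw [coe_algebraMap_adjoin, IsScalarTower.algebraMap_apply (ZInv n) ℚ ℚ⟮ξ⟯]
    exact (IsScalarTower.algebraMap_apply (ZInv n) ℚ ℂ x).symm

/-- The generator `ξ` of `ℤ[1/n][ξ]`. -/
noncomputable def xi : ZInvXi n ξ := ⟨ξ, Algebra.subset_adjoin rfl⟩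

@[simp]
theorem coe_xi : (xi n ξ : ℂ) = ξ := rfl

theorem adjoin_xi : Algebra.adjoin (ZInv n) {xi n ξ} = ⊤ := by
  rw [← Algebra.adjoin_adjoin_coe_preimage (s := {ξ})]
  congr 1
  ext x
  simp [Subtype.ext_iff]

variable {p : ℕ} {ξ} (hξ : IsPrimitiveRoot ξ p)
include hξ

theorem isPrimitiveRoot_gen : IsPrimitiveRoot (AdjoinSimple.gen ℚ ξ) p :=
  IsPrimitiveRoot.of_map_of_injective (f := algebraMap ℚ⟮ξ⟯ ℂ)
    (by simpa using hξ) (algebraMap ℚ⟮ξ⟯ ℂ).injective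

theorem xi_pow : xi n ξ ^ p = 1 := Subtype.ext (by simp [hξ.pow_eq_one])

variable [Fact p.Prime]

theorem isCyclotomicExtension_adjoin : IsCyclotomicExtension {p} ℚ ℚ⟮ξ⟯ := by
  have := hξ.adjoin_isCyclotomicExtension ℚ
  have h : IsAlgebraic ℚ ξ := (hξ.isIntegral (Fact.out : p.Prime).pos).tower_top.isAlgebraic
  exact IsCyclotomicExtension.equiv {p} ℚ (Algebra.adjoin ℚ {ξ})
    (Subalgebra.equivOfEq _ _ (adjoin_simple_toSubalgebra_of_isAlgebraic h).symm)

theorem finrank_adjoin : finrank ℚ ℚ⟮ξ⟯ = p - 1 := by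
  have := isCyclotomicExtension_adjoin hξ
  rw [IsCyclotomicExtension.finrank (n := p) ℚ⟮ξ⟯
    (Polynomial.cyclotomic.irreducible_rat (Fact.out : p.Prime).pos),
    Nat.totient_prime Fact.out]

theorem finiteDimensional_adjoin : FiniteDimensional ℚ ℚ⟮ξ⟯ :=
  have := isCyclotomicExtension_adjoin hξ
  IsCyclotomicExtension.finiteDimensional {p} ℚ ℚ⟮ξ⟯

theorem adjoin_algebraMap_xi :
    Algebra.adjoin ℚ {algebraMap (ZInvXi n ξ) ℚ⟮ξ⟯ (xi n ξ)} = ⊤ :=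
  have := isCyclotomicExtension_adjoin hξ
  IsCyclotomicExtension.adjoin_primitive_root_eq_top (isPrimitiveRoot_gen hξ)

theorem minpoly_algebraMap_xi :
    minpoly ℚ (algebraMap (ZInvXi n ξ) ℚ⟮ξ⟯ (xi n ξ)) = Polynomial.cyclotomic p ℚ :=
  (Polynomial.cyclotomic_eq_minpoly_rat (isPrimitiveRoot_gen hξ) (Fact.out : p.Prime).pos).symm

theorem isIntegral_xi : IsIntegral (ZInv n) (xi n ξ) :=
  ⟨Polynomial.X ^ p - 1, Polynomial.monic_X_pow_sub_C 1 (Fact.out : p.Prime).ne_zero, by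
    simp [xi_pow n hξ]⟩

theorem finite_ZInvXi : Module.Finite (ZInv n) (ZInvXi n ξ) := by
  refine Algebra.finite_adjoin_simple_of_isIntegral ?_
  simpa using (isIntegral_xi n hξ).map (ZInvXi n ξ).val

theorem isDedekindDomain_isFractionRing {n : ℤ} (hn : n ≠ 0) :
    IsDedekindDomain (ZInvXi n ξ) ∧ IsFractionRing (ZInvXi n ξ) ℚ⟮ξ⟯ := by
  have hn' : (n : ℂ) ≠ 0 := by exact_mod_cast hn
  have := isCyclotomicExtension_adjoin hξ
  have := finiteDimensional_adjoin hξ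
  let ζ := AdjoinSimple.gen ℚ ξ
  have hζ : (ζ : ℂ) = ξ := AdjoinSimple.coe_gen ℚ ξ
  let A := Algebra.adjoin ℤ {ζ}
  have : IsIntegralClosure A ℤ ℚ⟮ξ⟯ :=
    IsCyclotomicExtension.Rat.isIntegralClosure_adjoin_singleton_of_prime (isPrimitiveRoot_gen hξ)
  have : IsDedekindDomain A := IsIntegralClosure.isDedekindDomain ℤ ℚ ℚ⟮ξ⟯ A
  have : IsFractionRing A ℚ⟮ξ⟯ := IsIntegralClosure.isFractionRing_of_finite_extension ℤ ℚ ℚ⟮ξ⟯ A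
  have hA : ∀ x ∈ A, (x : ℂ) ∈ ZInvXi n ξ := by
    intro x hx
    induction hx using Algebra.adjoin_induction with
    | mem x hx =>
      rw [Set.mem_singleton_iff.1 hx, hζ]
      exact (xi n ξ).2
    | algebraMap z => simp
    | add x y _ _ hx hy => simpa using add_mem hx hy
    | mul x y _ _ hx hy => simpa using mul_mem hx hy
  let f : A →+* ZInvXi n ξ :=
    ((algebraMap ℚ⟮ξ⟯ ℂ).comp A.val.toRingHom).codRestrict (ZInvXi n ξ) fun x => hA x x.2
  let _ : Algebra A (ZInvXi n ξ) := f.toAlgebra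
  have hf : ∀ a : A, ((algebraMap A (ZInvXi n ξ) a : ZInvXi n ξ) : ℂ) = ((a : ℚ⟮ξ⟯) : ℂ) :=
    fun a => rfl
  have : IsScalarTower A (ZInvXi n ξ) ℚ⟮ξ⟯ := IsScalarTower.of_algebraMap_eq fun x => rfl
  have hsurj : ∀ x ∈ ZInvXi n ξ, ∃ (N : ℕ) (a : A), x * (n : ℂ) ^ N = ((a : ℚ⟮ξ⟯) : ℂ) := by
    intro x hx
    induction hx using Algebra.adjoin_induction with
    | mem x hx =>
      rw [Set.mem_singleton_iff.1 hx]
      exact ⟨0, ⟨ζ, Algebra.subset_adjoin rfl⟩, by simp [hζ]⟩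
    | algebraMap r =>
      obtain ⟨N, z, h⟩ := exists_mul_pow_eq_intCast hn r.2
      exact ⟨N, z, by simpa using h⟩
    | add x y _ _ hx hy =>
      obtain ⟨N, z, hx⟩ := hx
      obtain ⟨N', z', hy⟩ := hy
      refine ⟨N + N', z * n ^ N' + z' * n ^ N, ?_⟩
      push_cast
      rw [← hx, ← hy]
      ring
    | mul x y _ _ hx hy =>
      obtain ⟨N, z, hx⟩ := hx
      obtain ⟨N', z', hy⟩ := hy
      refine ⟨N + N', z * z', ?_⟩
      push_cast
      rw [← hx, ← hy]
      ring
  have : IsLocalization (Submonoid.powers (n : A)) (ZInvXi n ξ) := by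
    refine isLocalization_powers (fun a b h => ?_) ?_ fun b => ?_
    · have := congr_arg (fun x : ZInvXi n ξ => (x : ℂ)) h
      simpa only [hf, SetLike.coe_eq_coe] using this
    · refine IsUnit.of_mul_eq_one (algebraMap (ZInv n) _ ⟨_, inv_mem_ZInv n⟩) ?_
      ext
      simp only [map_intCast, MulMemClass.coe_mul, SubringClass.coe_intCast]
      exact mul_inv_cancel₀ hn'
    · obtain ⟨N, a, h⟩ := hsurj b b.2
      exact ⟨N, a, by ext; rw [hf, ← h]; simp⟩
  have hnA : (n : A) ≠ 0 := by exact_mod_cast hn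
  exact ⟨IsLocalization.isDedekindDomain A (powers_le_nonZeroDivisors_of_noZeroDivisors hnA) _,
    IsFractionRing.isFractionRing_of_isDomain_of_isLocalization (Submonoid.powers (n : A)) _ _⟩

end Cyclotomic

section EigenSpan

variable {R S l : Type*} [CommRing R] [CommRing S] [Algebra R S] [Fintype l] [DecidableEq l]

/-- `Y` has an eigenvector `α` for the eigenvalue `ξ` whose entries span the ideal `I` and with
`αᵀ J (τ α) = D a`. -/
def EigenSpan (τ : S ≃ₐ[R] S) (ξ D : S) (Y : Matrix (l ⊕ l) (l ⊕ l) R) (I : Ideal S) (a : S) :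
    Prop :=
  ∃ α : l ⊕ l → S, α ≠ 0 ∧ Y.map (algebraMap R S) *ᵥ α = ξ • α ∧
    I.restrictScalars R = Submodule.span R (Set.range α) ∧ skewForm τ α = D * a

theorem restrictScalars_span_singleton_mul {ι : Type*} {I : Ideal S} {α : ι → S}
    (hI : I.restrictScalars R = Submodule.span R (Set.range α)) (x : S) :
    (Ideal.span {x} * I).restrictScalars R = Submodule.span R (Set.range (x • α)) := by
  have h : Set.range (x • α) = LinearMap.mulLeft R x '' Set.range α := by
    rw [← Set.range_comp]
    rfl
  rw [h, Submodule.span_image, ← hI]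
  ext y
  rw [Submodule.restrictScalars_mem, Ideal.mem_span_singleton_mul]
  rfl

theorem span_range_mulVec_le {ι : Type*} [Fintype ι] (A : Matrix ι ι R) (α : ι → S) :
    Submodule.span R (Set.range (A.map (algebraMap R S) *ᵥ α)) ≤
      Submodule.span R (Set.range α) := by
  rw [Submodule.span_le]
  rintro _ ⟨i, rfl⟩
  simp only [Matrix.mulVec, dotProduct, Matrix.map_apply, ← Algebra.smul_def]
  exact Submodule.sum_mem _ fun k _ =>
    Submodule.smul_mem _ _ (Submodule.subset_span ⟨k, rfl⟩)

variable {τ : S ≃ₐ[R] S} {ξ D : S} {Y : Matrix (l ⊕ l) (l ⊕ l) R} {I J : Ideal S} {a b : S}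

theorem EigenSpan.of_conj (h : EigenSpan τ ξ D Y I a) {g Y' : Matrix (l ⊕ l) (l ⊕ l) R}
    (hg : g ∈ symplecticGroup l R) (hY : g * Y = Y' * g) : EigenSpan τ ξ D Y' I a := by
  obtain ⟨α, hα0, hα, hI, hform⟩ := h
  have hdet : IsUnit g.det := by rw [SymplecticGroup.det_eq_one hg]; exact isUnit_one
  have hinv : g⁻¹.map (algebraMap R S) *ᵥ (g.map (algebraMap R S) *ᵥ α) = α := by
    rw [Matrix.mulVec_mulVec, ← Matrix.map_mul, Matrix.nonsing_inv_mul g hdet,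
      Matrix.map_one _ (map_zero _) (map_one _), Matrix.one_mulVec]
  refine ⟨g.map (algebraMap R S) *ᵥ α, fun h => hα0 ?_, ?_, ?_, ?_⟩
  · rw [← hinv, h, Matrix.mulVec_zero]
  · rw [Matrix.mulVec_mulVec, ← Matrix.map_mul, ← hY, Matrix.map_mul, ← Matrix.mulVec_mulVec, hα,
      Matrix.mulVec_smul]
  · rw [hI]
    refine le_antisymm ?_ (span_range_mulVec_le g α)
    conv_lhs => rw [← hinv]
    exact span_range_mulVec_le _ _
  · rw [skewForm_mulVec τ hg, hform]

theorem EigenSpan.of_rel [IsDomain S] (h : EigenSpan τ ξ D Y I a) {x y : S} (hx : x ≠ 0)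
    (hy : y ≠ 0)
    (hIJ : Ideal.span {x} * I = Ideal.span {y} * J) (hab : x * τ x * a = y * τ y * b) :
    EigenSpan τ ξ D Y J b := by
  obtain ⟨α, hα0, hα, hI, hform⟩ := h
  have hmem : ∀ i, ∃ β ∈ J, y * β = x * α i := fun i => by
    rw [← Ideal.mem_span_singleton_mul, ← hIJ, Ideal.mem_span_singleton_mul]
    have : α i ∈ I.restrictScalars R := hI ▸ Submodule.subset_span ⟨i, rfl⟩
    exact ⟨α i, this, rfl⟩
  choose β hβJ hβ using hmem
  have hβ' : y • β = x • α := funext hβ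
  have hcancel : ∀ v w : l ⊕ l → S, y • v = y • w → v = w := fun v w h =>
    funext fun i => mul_left_cancel₀ hy (congr_fun h i)
  refine ⟨β, ?_, ?_, ?_, ?_⟩
  · rintro rfl
    refine hα0 (funext fun i => ?_)
    have := congr_fun hβ' i
    simpa [hx] using this.symm
  · apply hcancel
    rw [← Matrix.mulVec_smul, hβ', Matrix.mulVec_smul, hα, smul_comm, ← hβ', smul_comm]
  · apply le_antisymm
    · intro q hq
      have h1 : y * q ∈ (Ideal.span {y} * J).restrictScalars R :=
        Ideal.mem_span_singleton_mul.2 ⟨q, hq, rfl⟩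
      rw [← hIJ, restrictScalars_span_singleton_mul hI, ← hβ'] at h1
      obtain ⟨r, hr⟩ := (Submodule.mem_span_range_iff_exists_fun R).1 h1
      refine (Submodule.mem_span_range_iff_exists_fun R).2 ⟨r, mul_left_cancel₀ hy ?_⟩
      rw [← hr, Finset.mul_sum]
      exact Finset.sum_congr rfl fun i _ => by
        rw [Pi.smul_apply, smul_eq_mul, mul_smul_comm]
    · rw [Submodule.span_le]
      rintro _ ⟨i, rfl⟩
      exact hβJ i
  · have h1 := congr_arg (skewForm τ) hβ'
    rw [skewForm_smul, skewForm_smul, hform] at h1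
    have hτy : τ y ≠ 0 := by simpa using hy
    refine mul_left_cancel₀ (mul_ne_zero hy hτy) ?_
    linear_combination h1 + D * hab

theorem EigenSpan.rel [IsDomain S] (hD : D ≠ 0)
    (huniq : ∀ α β : l ⊕ l → S, α ≠ 0 → Y.map (algebraMap R S) *ᵥ α = ξ • α → β ≠ 0 →
      Y.map (algebraMap R S) *ᵥ β = ξ • β → ∃ x y : S, x ≠ 0 ∧ y ≠ 0 ∧ x • α = y • β)
    (h : EigenSpan τ ξ D Y I a) (h' : EigenSpan τ ξ D Y J b) :
    ∃ x y : S, x ≠ 0 ∧ y ≠ 0 ∧ Ideal.span {x} * I = Ideal.span {y} * J ∧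
      x * τ x * a = y * τ y * b := by
  obtain ⟨α, hα0, hα, hI, hform⟩ := h
  obtain ⟨β, hβ0, hβ, hJ, hform'⟩ := h'
  obtain ⟨x, y, hx, hy, hxy⟩ := huniq α β hα0 hα hβ0 hβ
  refine ⟨x, y, hx, hy, ?_, ?_⟩
  · apply Submodule.restrictScalars_injective R
    rw [restrictScalars_span_singleton_mul hI, restrictScalars_span_singleton_mul hJ, hxy]
  · have h1 := congr_arg (skewForm τ) hxy
    rw [skewForm_smul, skewForm_smul, hform, hform'] at h1
    refine mul_left_cancel₀ hD ?_
    linear_combination h1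

end EigenSpan

section Conjugation

variable (n : ℤ) {ξ : ℂ} {p : ℕ} [Fact p.Prime] (hξ : IsPrimitiveRoot ξ p)
include hξ

theorem conj_mul_self_of_isPrimitiveRoot : conj ξ * ξ = 1 := by
  have h : ‖ξ‖ = 1 := hξ.norm'_eq_one (Fact.out : p.Prime).ne_zero
  rw [mul_comm, Complex.mul_conj, Complex.normSq_eq_norm_sq, h]
  norm_num

theorem conj_mem_ZInvXi {x : ℂ} (hx : x ∈ ZInvXi n ξ) : conj x ∈ ZInvXi n ξ := by
  have h1 := conj_mul_self_of_isPrimitiveRoot hξ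
  have hp1 : 1 ≤ p := (Fact.out : p.Prime).one_le
  have h2 : conj ξ = ξ ^ (p - 1) := by
    calc conj ξ = conj ξ * ξ ^ (p - 1 + 1) := by
          rw [Nat.sub_add_cancel hp1, hξ.pow_eq_one, mul_one]
      _ = (conj ξ * ξ) * ξ ^ (p - 1) := by ring
      _ = ξ ^ (p - 1) := by rw [h1, one_mul]
  induction hx using Algebra.adjoin_induction with
  | mem x hx =>
    rw [Set.mem_singleton_iff.1 hx, h2]
    exact pow_mem (xi n ξ).2 _
  | algebraMap r =>
    rw [conj_ZInv]
    exact Subalgebra.algebraMap_mem _ r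
  | add x y _ _ hx hy => rw [map_add]; exact add_mem hx hy
  | mul x y _ _ hx hy => rw [map_mul]; exact mul_mem hx hy

/-- Complex conjugation on `ℤ[1/n][ξ]`. -/
noncomputable def conjAut : ZInvXi n ξ ≃ₐ[ZInv n] ZInvXi n ξ where
  toFun x := ⟨conj (x : ℂ), conj_mem_ZInvXi n hξ x.2⟩
  invFun x := ⟨conj (x : ℂ), conj_mem_ZInvXi n hξ x.2⟩
  left_inv x := by simp
  right_inv x := by simp
  map_mul' x y := by ext; simp
  map_add' x y := by ext; simp
  commutes' r := by ext; exact conj_ZInv n r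

@[simp]
theorem coe_conjAut (x : ZInvXi n ξ) : (conjAut n hξ x : ℂ) = conj (x : ℂ) := rfl

theorem conjAut_conjAut (x : ZInvXi n ξ) : conjAut n hξ (conjAut n hξ x) = x := by
  ext; simp

theorem conjAut_xi_mul : conjAut n hξ (xi n ξ) * xi n ξ = 1 := by
  ext; simp [conj_mul_self_of_isPrimitiveRoot hξ]

theorem conjIdeal_eq_map (I : Ideal (ZInvXi n ξ)) : conjIdeal I = I.map (conjAut n hξ) := by
  rw [conjIdeal, Ideal.map]
  congr 1
  ext y
  constructor
  · rintro ⟨x, hx, hy⟩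
    exact ⟨x, hx, Subtype.ext hy.symm⟩
  · rintro ⟨x, hx, rfl⟩
    exact ⟨x, hx, rfl⟩

theorem coe_skewForm {l : Type*} [Fintype l] [DecidableEq l] (α : l ⊕ l → ZInvXi n ξ) :
    ((skewForm (conjAut n hξ) α : ZInvXi n ξ) : ℂ) = sympForm fun i => (α i : ℂ) := by
  change (ZInvXi n ξ).val (skewForm (conjAut n hξ) α) =
    skewForm (starRingEnd ℂ) fun i => (α i : ℂ)
  simp only [skewForm_eq_sum, map_sum, map_sub, map_mul]
  rfl

theorem xi_ne_one : ξ ≠ 1 := hξ.ne_one (Fact.out : p.Prime).one_lt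

theorem diffGen_ne_zero : diffGen p ξ ≠ 0 := by
  have h0 : ξ ≠ 0 := hξ.ne_zero (Fact.out : p.Prime).ne_zero
  have h1 : (p : ℂ) ≠ 0 := by exact_mod_cast (Fact.out : p.Prime).ne_zero
  exact div_ne_zero (mul_ne_zero h1 (pow_ne_zero _ h0)) (sub_ne_zero.2 (xi_ne_one hξ))

theorem conj_diffGen (hp2 : p ≠ 2) : conj (diffGen p ξ) = -diffGen p ξ := by
  have h0 : ξ ≠ 0 := hξ.ne_zero (Fact.out : p.Prime).ne_zero
  have h1 : ξ - 1 ≠ 0 := sub_ne_zero.2 (xi_ne_one hξ)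
  have h2 : conj ξ = ξ⁻¹ := eq_inv_of_mul_eq_one_left (conj_mul_self_of_isPrimitiveRoot hξ)
  have h3 : ξ⁻¹ - 1 ≠ 0 := fun h => h1 (by
    rw [sub_eq_zero, inv_eq_one] at h
    rw [h, sub_self])
  obtain ⟨k, hk⟩ := (Fact.out : p.Prime).odd_of_ne_two hp2
  have h4 : (p + 1) / 2 = k + 1 := by omega
  have h5 : ξ * (ξ ^ k * ξ ^ k) = 1 := by
    rw [← hξ.pow_eq_one, hk]
    ring
  have hk0 : ξ ^ k ≠ 0 := pow_ne_zero _ h0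
  rw [diffGen, h4, map_div₀, map_mul, map_sub, map_pow, map_natCast, map_one, h2, inv_pow,
    ← neg_div, div_eq_div_iff h3 h1, pow_succ]
  field_simp
  linear_combination (p : ℂ) * (1 - ξ) * h5

end Conjugation

section Different

variable {n : ℤ} (hn : n ≠ 0) {ξ : ℂ} {p : ℕ} [Fact p.Prime] (hξ : IsPrimitiveRoot ξ p)
include hn hξ

theorem minpoly_xi : minpoly (ZInv n) (xi n ξ) = Polynomial.cyclotomic p (ZInv n) := by
  have := isFractionRing_ZInv hn
  have := isPrincipalIdealRing_ZInv hn
  apply Polynomial.map_injective (algebraMap (ZInv n) ℚ) (IsFractionRing.injective (ZInv n) ℚ)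
  rw [← minpoly.isIntegrallyClosed_eq_field_fractions ℚ ℚ⟮ξ⟯ (isIntegral_xi n hξ),
    minpoly_algebraMap_xi n hξ, Polynomial.map_cyclotomic]

theorem sub_one_mul_aeval_derivative :
    (xi n ξ - 1) * Polynomial.aeval (xi n ξ) (Polynomial.derivative (minpoly (ZInv n) (xi n ξ))) =
      p * xi n ξ ^ (p - 1) := by
  rw [minpoly_xi hn hξ]
  exact sub_one_mul_aeval_derivative_cyclotomic (by rw [← minpoly_xi hn hξ, minpoly.aeval])

theorem exists_diffGen : ∃ D : ZInvXi n ξ, (D : ℂ) = diffGen p ξ ∧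
    Ideal.span {D} = Ideal.span {Polynomial.aeval (xi n ξ)
      (Polynomial.derivative (minpoly (ZInv n) (xi n ξ)))} := by
  have hxi : IsUnit (xi n ξ) := IsUnit.of_pow_eq_one (xi_pow n hξ) (Fact.out : p.Prime).ne_zero
  refine ⟨_ * xi n ξ ^ ((p + 1) / 2 + 1), ?_, Ideal.span_singleton_mul_right_unit (hxi.pow _) _⟩
  have h := congr_arg (fun x : ZInvXi n ξ => (x : ℂ)) (sub_one_mul_aeval_derivative hn hξ)
  simp only [MulMemClass.coe_mul, AddSubgroupClass.coe_sub, OneMemClass.coe_one, coe_xi,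
    SubmonoidClass.coe_pow, SubringClass.coe_natCast] at h ⊢
  have h1 : ξ - 1 ≠ 0 := sub_ne_zero.2 (xi_ne_one hξ)
  rw [diffGen, eq_div_iff h1]
  have hp1 : p - 1 + 1 = p := Nat.sub_add_cancel (Fact.out : p.Prime).one_le
  have h2 : ξ ^ (p - 1) * ξ = 1 := by rw [← pow_succ, hp1, hξ.pow_eq_one]
  linear_combination ξ ^ ((p + 1) / 2 + 1) * h + p * ξ ^ ((p + 1) / 2) * h2

end Different

theorem corresponds_iff_eigenSpan {p : ℕ} [Fact p.Prime] {n : ℤ} {ξ : ℂ}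
    (hξ : IsPrimitiveRoot ξ p) {D : ZInvXi n ξ} (hD : (D : ℂ) = diffGen p ξ) (Y : Sp p n)
    (P : IdealPair n ξ) :
    Corresponds Y P ↔ EigenSpan (conjAut n hξ) (xi n ξ) D Y.1
      P.ideal P.gen := by
  refine exists_congr fun α => and_congr Iff.rfl (and_congr ?_ (and_congr Iff.rfl ?_))
  · have h : (Y.1.map (algebraMap (ZInv n) ℂ)).mulVec
        (fun i => (α i : ℂ)) = fun i =>
        (((Y.1.map (algebraMap (ZInv n) (ZInvXi n ξ)) *ᵥ α) i : _) : ℂ) := by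
      ext i
      simp [Matrix.mulVec, dotProduct]
    rw [h]
    constructor
    · intro h'
      exact funext fun i => Subtype.ext (congr_fun h' i)
    · intro h'
      exact funext fun i => congr_arg Subtype.val (congr_fun h' i)
  · rw [← coe_skewForm n hξ, ← hD, eq_inv_mul_iff_mul_eq₀ (hD ▸ diffGen_ne_zero hξ), eq_comm,
      ← MulMemClass.coe_mul, SetLike.coe_eq_coe]

section Classification

variable {p : ℕ} [Fact p.Prime] (hp2 : p ≠ 2) {n : ℤ} (hn : n ≠ 0) {ξ : ℂ}
  (hξ : IsPrimitiveRoot ξ p)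
include hp2 hn hξ

omit hn in
theorem finrank_eq_half_add_half : finrank ℚ ℚ⟮ξ⟯ = (p - 1) / 2 + (p - 1) / 2 := by
  rw [finrank_adjoin hξ]
  obtain ⟨k, hk⟩ := (Fact.out : p.Prime).odd_of_ne_two hp2
  omega

theorem exists_corresponds (Y : Sp p n) (hY : orderOf Y = p) :
    ∃ P : IdealPair n ξ, Corresponds Y P := by
  have := isFractionRing_ZInv hn
  have := isPrincipalIdealRing_ZInv hn
  obtain ⟨_, _⟩ := isDedekindDomain_isFractionRing hξ hn
  have := finiteDimensional_adjoin hξ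
  have := finite_ZInvXi n hξ
  have : IsIntegralClosure (ZInvXi n ξ) (ZInv n) ℚ⟮ξ⟯ :=
    IsIntegralClosure.of_isIntegrallyClosed _ _ _
  obtain ⟨D, hD, hDspan⟩ := exists_diffGen hn hξ
  have hD0 : D ≠ 0 := by
    rintro rfl
    exact diffGen_ne_zero hξ hD.symm
  have hdual := dual_one_eq_spanSingleton (F := ℚ) (L := ℚ⟮ξ⟯) (adjoin_xi n ξ)
    (adjoin_algebraMap_xi n hξ) hDspan
  have hY1 : Y.1 ≠ 1 := fun h => by
    have : Y = 1 := Subtype.ext h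
    rw [this, orderOf_one] at hY
    exact (Fact.out : p.Prime).one_lt.ne hY
  have hYp : Y.1 ^ p = 1 := by
    have := congr_arg Subtype.val (pow_orderOf_eq_one Y)
    rwa [hY] at this
  obtain ⟨α, hα0, hα⟩ := exists_mulVec_eq_smul (L := ℚ⟮ξ⟯) (minpoly_algebraMap_xi n hξ) hY1 hYp
  obtain ⟨I, hI⟩ := exists_ideal_of_mulVec (adjoin_xi n ξ) hα
  obtain ⟨a, ha0, ha, haI⟩ := exists_gen_of_mulVec (adjoin_algebraMap_xi n hξ)
    (finrank_eq_half_add_half hp2 hξ) (conjAut n hξ) (conjAut_xi_mul n hξ) hD0 hdual Y.2 hα0 hα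
    hI
  have hDτ : conjAut n hξ D = -D := by ext; simp [hD, conj_diffGen hξ hp2]
  have haτ : conjAut n hξ a = a := by
    have h := map_skewForm (conjAut n hξ) (conjAut_conjAut n hξ) α
    rw [ha, map_mul, hDτ] at h
    refine mul_left_cancel₀ hD0 ?_
    linear_combination -h
  exact ⟨⟨I, a, ha0, congr_arg Subtype.val haτ, by rw [conjIdeal_eq_map n hξ, haI]⟩,
    (corresponds_iff_eigenSpan hξ hD _ _).2 ⟨α, hα0, hα, hI, ha⟩⟩

theorem exists_corresponds_of_pair (P : IdealPair n ξ) :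
    ∃ Y : Sp p n, orderOf Y = p ∧ Corresponds Y P := by
  have := isFractionRing_ZInv hn
  have := isPrincipalIdealRing_ZInv hn
  obtain ⟨_, _⟩ := isDedekindDomain_isFractionRing hξ hn
  have := finiteDimensional_adjoin hξ
  have := finite_ZInvXi n hξ
  have : IsIntegralClosure (ZInvXi n ξ) (ZInv n) ℚ⟮ξ⟯ :=
    IsIntegralClosure.of_isIntegrallyClosed _ _ _
  obtain ⟨D, hD, hDspan⟩ := exists_diffGen hn hξ
  have hD0 : D ≠ 0 := by
    rintro rfl
    exact diffGen_ne_zero hξ hD.symm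
  have hdual := dual_one_eq_spanSingleton (F := ℚ) (L := ℚ⟮ξ⟯) (adjoin_xi n ξ)
    (adjoin_algebraMap_xi n hξ) hDspan
  have hDτ : conjAut n hξ D = -D := by ext; simp [hD, conj_diffGen hξ hp2]
  obtain ⟨Y, hY, α, hα0, hα, hI, hform⟩ := exists_symplectic_mulVec (adjoin_algebraMap_xi n hξ)
    (finrank_eq_half_add_half hp2 hξ) (conjAut n hξ) (conjAut_xi_mul n hξ)
    (conjAut_conjAut n hξ) hD0 hDτ hdual P.gen_ne_zero (Subtype.ext P.conj_gen)
    (by rw [← conjIdeal_eq_map n hξ, P.mul_conj])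
  refine ⟨⟨Y, hY⟩, orderOf_eq_prime (Subtype.ext ?_) fun h => ?_,
    (corresponds_iff_eigenSpan hξ hD _ _).2 ⟨α, hα0, hα, hI, hform⟩⟩
  · obtain ⟨b, hb⟩ := exists_basis_of_mulVec (adjoin_algebraMap_xi n hξ)
      (by simp [finrank_eq_half_add_half hp2 hξ]) hα0 hα
    exact pow_eq_one_of_mulVec (xi_pow n hξ) hb hα
  · exact ne_one_of_mulVec (fun h => xi_ne_one hξ (congr_arg Subtype.val h)) hα0 hα
      (congr_arg Subtype.val h)

theorem isConj_of_corresponds {Y Y' : Sp p n} {P : IdealPair n ξ} (hY : Corresponds Y P)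
    (hY' : Corresponds Y' P) : IsConj Y Y' := by
  have := isFractionRing_ZInv hn
  obtain ⟨_, _⟩ := isDedekindDomain_isFractionRing hξ hn
  have := finiteDimensional_adjoin hξ
  obtain ⟨D, hD, -⟩ := exists_diffGen hn hξ
  obtain ⟨α, hα0, hα, hI, hform⟩ := (corresponds_iff_eigenSpan hξ hD _ _).1 hY
  obtain ⟨β, hβ0, hβ, hI', hform'⟩ := (corresponds_iff_eigenSpan hξ hD _ _).1 hY'
  obtain ⟨g, hg, h⟩ := exists_conj_of_mulVec (adjoin_algebraMap_xi n hξ)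
    (finrank_eq_half_add_half hp2 hξ) (conjAut n hξ) (conjAut_xi_mul n hξ) Y.2 Y'.2 hα0 hα
    hβ0 hβ (hI.symm.trans hI') (hform.trans hform'.symm)
  refine isConj_iff.2 ⟨⟨g, hg⟩, ?_⟩
  rw [mul_inv_eq_iff_eq_mul]
  exact Subtype.ext h

theorem rel_of_corresponds {Y : Sp p n} {P Q : IdealPair n ξ} (hP : Corresponds Y P)
    (hQ : Corresponds Y Q) : P.Rel Q := by
  obtain ⟨_, _⟩ := isDedekindDomain_isFractionRing hξ hn
  obtain ⟨D, hD, -⟩ := exists_diffGen hn hξ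
  have hD0 : D ≠ 0 := by
    rintro rfl
    exact diffGen_ne_zero hξ hD.symm
  rw [corresponds_iff_eigenSpan hξ hD] at hP hQ
  obtain ⟨x, y, hx, hy, h, h'⟩ := hP.rel hD0 (fun α β hα0 hα hβ0 hβ =>
    exists_smul_eq_smul_of_mulVec (adjoin_algebraMap_xi n hξ)
      (by simp [finrank_eq_half_add_half hp2 hξ]) hα0 hα hβ0 hβ) hQ
  exact ⟨x, y, hx, hy, h, congr_arg Subtype.val h'⟩

omit hp2 in
theorem corresponds_of_rel {Y : Sp p n} {P Q : IdealPair n ξ} (hP : Corresponds Y P)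
    (hPQ : P.Rel Q) : Corresponds Y Q := by
  obtain ⟨D, hD, -⟩ := exists_diffGen hn hξ
  rw [corresponds_iff_eigenSpan hξ hD] at hP ⊢
  obtain ⟨x, y, hx, hy, h, h'⟩ := hPQ
  exact hP.of_rel hx hy h (Subtype.ext h')

omit hp2 in
theorem corresponds_of_isConj {Y Y' : Sp p n} {P : IdealPair n ξ} (hY : Corresponds Y P)
    (h : IsConj Y Y') : Corresponds Y' P := by
  obtain ⟨D, hD, -⟩ := exists_diffGen hn hξ
  rw [corresponds_iff_eigenSpan hξ hD] at hY ⊢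
  obtain ⟨g, hg⟩ := isConj_iff.1 h
  exact hY.of_conj g.2 (congr_arg Subtype.val (mul_inv_eq_iff_eq_mul.1 hg))

end Classification

end SpPairs

theorem mainTheorem2 (p : ℕ) (hp : p.Prime) (hp2 : p ≠ 2) (n : ℤ) (hn : n ≠ 0)
    (ξ : ℂ) (hξ : IsPrimitiveRoot ξ p) :
    ∃ ψ : SpPairs.OrderPClasses p n → SpPairs.PairClasses n ξ,
      Function.Bijective ψ ∧
      ∀ (Y : SpPairs.Sp p n) (hY : orderOf Y = p) (P : SpPairs.IdealPair n ξ),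
        ψ ⟨ConjClasses.mk Y, Y, hY, rfl⟩ = Quotient.mk (SpPairs.IdealPair.setoid n ξ) P ↔
          SpPairs.Corresponds Y P := by
  have : Fact p.Prime := ⟨hp⟩
  choose P hP using fun c : SpPairs.OrderPClasses p n =>
    SpPairs.exists_corresponds hp2 hn hξ c.2.choose c.2.choose_spec.1
  have hrep : ∀ c : SpPairs.OrderPClasses p n, ConjClasses.mk c.2.choose = c.1 :=
    fun c => c.2.choose_spec.2
  have key : ∀ (Y : SpPairs.Sp p n) (hY : orderOf Y = p) (Q : SpPairs.IdealPair n ξ),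
      Quotient.mk (SpPairs.IdealPair.setoid n ξ) (P ⟨ConjClasses.mk Y, Y, hY, rfl⟩) =
        Quotient.mk (SpPairs.IdealPair.setoid n ξ) Q ↔ SpPairs.Corresponds Y Q := by
    intro Y hY Q
    have hconj := ConjClasses.mk_eq_mk_iff_isConj.1 (hrep ⟨ConjClasses.mk Y, Y, hY, rfl⟩)
    constructor
    · intro h
      exact SpPairs.corresponds_of_isConj hn hξ
        (SpPairs.corresponds_of_rel hn hξ (hP _) (Quotient.exact h)) hconj
    · intro h
      exact Quotient.sound (SpPairs.rel_of_corresponds hp2 hn hξ (hP _)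
        (SpPairs.corresponds_of_isConj hn hξ h hconj.symm))
  refine ⟨fun c => Quotient.mk _ (P c), ⟨?_, ?_⟩, key⟩
  · rintro ⟨_, Y, hY, rfl⟩ ⟨_, Y', hY', rfl⟩ h
    obtain ⟨Q, hQ⟩ := Quotient.exists_rep (Quotient.mk (SpPairs.IdealPair.setoid n ξ)
      (P ⟨ConjClasses.mk Y, Y, hY, rfl⟩))
    have h1 := (key Y hY Q).1 hQ.symm
    have h2 := (key Y' hY' Q).1 (h.symm.trans hQ.symm)
    exact Subtype.ext (ConjClasses.mk_eq_mk_iff_isConj.2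
      (SpPairs.isConj_of_corresponds hp2 hn hξ h1 h2))
  · intro q
    obtain ⟨Q, rfl⟩ := Quotient.exists_rep q
    obtain ⟨Y, hY, h⟩ := SpPairs.exists_corresponds_of_pair hp2 hn hξ Q
    exact ⟨⟨ConjClasses.mk Y, Y, hY, rfl⟩, (key Y hY Q).2 h⟩
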